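/- Let $A=(a_{ij})_{i,j=-1,0,\dots,8}$ be the Cartan matrix of $E_{10}$: $a_{ii}=2$; for $i\ne j$, $a_{ij}=-1$ if the nodes $i,j$ are joined in the Dynkin diagram and $a_{ij}=0$ otherwise, where the diagram has edges $\{i,i+1\}$ for $-1\le i\le 6$ and $\{5,8\}$. Since $\det A=-1$, take a real vector space $\mathfrak h_{\mathbb R}$ with basis $\alpha_{-1}^\vee,\dots,\alpha_8^\vee$ and let $\alpha_{-1},\dots,\alpha_8$ be the basis of $\mathfrak h_{\mathbb R}^*$ with $\alpha_j(\alpha_i^\vee)=a_{ij}$. Let $\mathfrak g=E_{10}$ be the complex Lie algebra generated by $\mathfrak h_{\mathbb R}$ (real-linearly) and $e_i,f_i$ ($-1\le i\le 8$) with the relations $[h,h']=0$, $[e_i,f_j]=\delta_{ij}\alpha_i^\vee$, $[h,e_i]=\alpha_i(h)e_i$, $[h,f_i]=-\alpha_i(h)f_i$ for $h,h'\in\mathfrak h_{\mathbb R}$, and $\mathrm{ad}(e_i)^{1-a_{ij}}e_j=\mathrm{ad}(f_i)^{1-a_{ij}}f_j=0$ for $i\neq j$. For $\alpha\in\mathfrak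 h_{\mathbb R}^*$ put $\mathfrak g_\alpha=\{x\in\mathfrak g:[h,x]=\alpha(h)x\ \ \forall h\in\mathfrak h_{\mathbb R}\}$; $\alpha$ is a root if $\alpha\neq0$ and $\mathfrak g_\alpha\ne0$, and its multiplicity is $\dim_{\mathbb C}\mathfrak g_\alpha$. Let $(\cdot|\cdot)$ be the symmetric bilinear form on $\mathfrak h_{\mathbb R}^*$ with $(\alpha_i|\alpha_j)=a_{ij}$; a root $\alpha$ is imaginary if $(\alpha|\alpha)\le0$. Let $W$ be the group of linear automorphisms of $\mathfrak h_{\mathbb R}^*$ generated by the reflections $r_i(\lambda)=\lambda-\lambda(\alpha_i^\vee)\alpha_i$, $-1\le i\le 8$, and let $$\delta=\alpha_0+2\alpha_1+3\alpha_2+4\alpha_3+5\alpha_4+6\alpha_5+4\alpha_6+2\alpha_7+3\alpha_8.$$ Then for every imaginary root $\alpha$ of $E_{10}$ with $(\alpha|\alpha)=0$ there are $w\in W$ and an integer $n\neq0$ with $w(\alpha)=n\delta$, and the multiplicity of $\alpha$ is exactly $8$. -/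

import Mathlib

noncomputable section

namespace ETen

/-- The Cartan matrix of `E₁₀`. The index `k : Fin 10` stands for the node `k - 1` of the Dynkin
diagram, whose nodes are `-1, 0, 1, …, 8`: the nodes `-1, 0, …, 7` form a chain, in this order, and
the node `8` (index `9`) is joined to the node `5` (index `6`) only. -/
def cartanMatrix : Matrix (Fin 10) (Fin 10) ℤ :=
  !![ 2, -1,  0,  0,  0,  0,  0,  0,  0,  0;
     -1,  2, -1,  0,  0,  0,  0,  0,  0,  0;
      0, -1,  2, -1,  0,  0,  0,  0,  0,  0;
      0,  0, -1,  2, -1,  0,  0,  0,  0,  0;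
      0,  0,  0, -1,  2, -1,  0,  0,  0,  0;
      0,  0,  0,  0, -1,  2, -1,  0,  0,  0;
      0,  0,  0,  0,  0, -1,  2, -1,  0, -1;
      0,  0,  0,  0,  0,  0, -1,  2, -1,  0;
      0,  0,  0,  0,  0,  0,  0, -1,  2,  0;
      0,  0,  0,  0,  0,  0, -1,  0,  0,  2]

/-- The Kac-Moody algebra `E₁₀` over `ℂ`: generators `H i, E i, F i` and the Serre relations of
`cartanMatrix`. As the Cartan matrix is invertible, the simple coroots `H i` are a basis of the
Cartan subalgebra, and no further generators are needed. -/
abbrev Alg : Type := Matrix.ToLieAlgebra ℂ cartanMatrix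

/-- The image of the generator `H i` in `E₁₀`. -/
def genH (i : Fin 10) : Alg :=
  (LieSubmodule.Quotient.mk (FreeLieAlgebra.of ℂ (CartanMatrix.Generators.H i)) :
    FreeLieAlgebra ℂ (CartanMatrix.Generators (Fin 10)) ⧸
      CartanMatrix.Relations.toIdeal ℂ cartanMatrix)

/-- The real Cartan subalgebra: the real vector space on the simple coroots. -/
abbrev Cartan : Type := Fin 10 → ℝ

/-- The simple coroots. -/
def coroot (i : Fin 10) : Cartan := Pi.single i 1

/-- The real-linear map from the Cartan subalgebra to `E₁₀` that sends the `i`-th simple coroot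
to `H i`. -/
def toAlg (h : Cartan) : Alg := ∑ i, (h i : ℂ) • genH i

/-- The simple roots: the linear forms `α_j` with `α_j (α_i^∨) = a_ij`. -/
def simpleRoot (j : Fin 10) : Module.Dual ℝ Cartan :=
  ∑ i, (cartanMatrix i j : ℝ) • LinearMap.proj i

theorem simpleRoot_coroot (i j : Fin 10) : simpleRoot j (coroot i) = cartanMatrix i j := by
  simp [simpleRoot, coroot, Pi.single_apply]

/-- The inverse of the Cartan matrix, only used to see that the simple roots are a basis. -/
def cartanMatrixInv : Matrix (Fin 10) (Fin 10) ℤ :=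
  -!![0, 1, 2, 3, 4, 5, 6, 4, 2, 3;
      1, 2, 4, 6, 8, 10, 12, 8, 4, 6;
      2, 4, 6, 9, 12, 15, 18, 12, 6, 9;
      3, 6, 9, 12, 16, 20, 24, 16, 8, 12;
      4, 8, 12, 16, 20, 25, 30, 20, 10, 15;
      5, 10, 15, 20, 25, 30, 36, 24, 12, 18;
      6, 12, 18, 24, 30, 36, 42, 28, 14, 21;
      4, 8, 12, 16, 20, 24, 28, 18, 9, 14;
      2, 4, 6, 8, 10, 12, 14, 9, 4, 7;
      3, 6, 9, 12, 15, 18, 21, 14, 7, 10]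

theorem cartanMatrixInv_mul (i j : Fin 10) :
    ∑ k, cartanMatrixInv i k * cartanMatrix k j = if i = j then 1 else 0 := by
  revert i j; decide

theorem linearIndependent_simpleRoot : LinearIndependent ℝ simpleRoot := by
  rw [Fintype.linearIndependent_iff]
  intro g hg i
  have h1 : ∀ k, ∑ j, (cartanMatrix k j : ℝ) * g j = 0 := fun k => by
    have := LinearMap.congr_fun hg (coroot k)
    simpa [simpleRoot_coroot, mul_comm] using this
  have h2 : ∀ j, ∑ k, (cartanMatrixInv i k : ℝ) * (cartanMatrix k j : ℝ) =
      if i = j then 1 else 0 := fun j => by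
    have := congrArg (Int.cast : ℤ → ℝ) (cartanMatrixInv_mul i j)
    push_cast at this
    exact this
  have h3 : ∑ k, (cartanMatrixInv i k : ℝ) * ∑ j, (cartanMatrix k j : ℝ) * g j = g i := by
    simp_rw [Finset.mul_sum]
    rw [Finset.sum_comm]
    simp_rw [← mul_assoc, ← Finset.sum_mul, h2]
    simp
  rw [← h3]
  simp [h1]

/-- The simple roots, as a basis of the dual of the Cartan subalgebra. -/
def simpleRootBasis : Module.Basis (Fin 10) ℝ (Module.Dual ℝ Cartan) :=
  basisOfLinearIndependentOfCardEqFinrank linearIndependent_simpleRoot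
    (by simp [Subspace.dual_finrank_eq])

theorem simpleRootBasis_apply (i : Fin 10) : simpleRootBasis i = simpleRoot i := by
  simp [simpleRootBasis]

/-- The invariant symmetric bilinear form `(· | ·)` on the dual of the Cartan subalgebra, given by
`(α_i | α_j) = a_ij`. -/
def form : LinearMap.BilinForm ℝ (Module.Dual ℝ Cartan) :=
  Matrix.toBilin simpleRootBasis (cartanMatrix.map (Int.cast : ℤ → ℝ))

theorem form_simpleRoot (i j : Fin 10) :
    form (simpleRoot i) (simpleRoot j) = cartanMatrix i j := by
  rw [← simpleRootBasis_apply, ← simpleRootBasis_apply, form, Matrix.toBilin_apply]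
  simp [Finsupp.single_apply]

/-- The root space `{x | [h, x] = α(h) x for all h}`. -/
def rootSpace (α : Module.Dual ℝ Cartan) : Submodule ℂ Alg where
  carrier := {x | ∀ h : Cartan, ⁅toAlg h, x⁆ = ((α h : ℝ) : ℂ) • x}
  add_mem' := fun {x y} hx hy h => by rw [lie_add, hx h, hy h, smul_add]
  zero_mem' := fun h => by rw [lie_zero, smul_zero]
  smul_mem' := fun c x hx h => by rw [lie_smul, hx h, smul_comm]

/-- The roots of `E₁₀`. -/
def roots : Set (Module.Dual ℝ Cartan) := {α | rootSpace α ≠ ⊥ ∧ α ≠ 0}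

/-- The imaginary roots of `E₁₀`. -/
def imaginaryRoots : Set (Module.Dual ℝ Cartan) := {α | α ∈ roots ∧ form α α ≤ 0}

/-- The multiplicity of a root: the complex dimension of its root space, as a cardinal. -/
def multiplicity (α : Module.Dual ℝ Cartan) : Cardinal := Module.rank ℂ (rootSpace α)

theorem eval_coroot_simpleRoot (i : Fin 10) :
    Module.Dual.eval ℝ Cartan (coroot i) (simpleRoot i) = 2 := by
  have h : ∀ i, cartanMatrix i i = 2 := by decide
  rw [Module.Dual.eval_apply, simpleRoot_coroot, h i]
  norm_num

/-- The simple reflection `r_i(λ) = λ - λ(α_i^∨) α_i`. -/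
def simpleReflection (i : Fin 10) : Module.Dual ℝ Cartan ≃ₗ[ℝ] Module.Dual ℝ Cartan :=
  Module.reflection (eval_coroot_simpleRoot i)

theorem simpleReflection_apply (i : Fin 10) (l : Module.Dual ℝ Cartan) :
    simpleReflection i l = l - l (coroot i) • simpleRoot i := by
  simp [simpleReflection, Module.reflection_apply]

/-- The Weyl group, generated by the simple reflections. -/
def weylGroup : Subgroup (Module.Dual ℝ Cartan ≃ₗ[ℝ] Module.Dual ℝ Cartan) :=
  Subgroup.closure (Set.range simpleReflection)

/-- `δ = α₀ + 2α₁ + 3α₂ + 4α₃ + 5α₄ + 6α₅ + 4α₆ + 2α₇ + 3α₈`; the index of a simple root is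
shifted by one, as in `cartanMatrix`. -/
def delta : Module.Dual ℝ Cartan :=
  simpleRoot 1 + (2 : ℤ) • simpleRoot 2 + (3 : ℤ) • simpleRoot 3 + (4 : ℤ) • simpleRoot 4 +
    (5 : ℤ) • simpleRoot 5 + (6 : ℤ) • simpleRoot 6 + (4 : ℤ) • simpleRoot 7 +
    (2 : ℤ) • simpleRoot 8 + (3 : ℤ) • simpleRoot 9

end ETen

end

/-! Indices are those of `Fin 10`: index 0 is the overextended node, the others form the affine
diagram with null root δ. A is the Cartan matrix.

Root combinatorics reduces the claim to positive multiples of δ. By the triangular decomposition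
every root is an integral combination of simple roots with coefficients of one sign (`root_cases`),
and the Chevalley involution exchanges the signs. Exponentials of ad e_i and ad f_i lift the Weyl
group to automorphisms, so multiplicities are W-invariant. Lowering the height of a positive root of
nonnegative norm by reflections ends at a simple root or in the antidominant cone, whose isotropic
elements are multiples of δ by the signs of the entries of A⁻¹ (`exists_weyl_of_pos`). Hence roots
have norm at most 2, and those of norm 2 have multiplicity one. That the e_i are nonzero at all is
shown on a highest weight module (`genH_ne_zero`).

The space g_{nδ}, n > 0, is computed without a loop realisation. For i ≠ 0 the line g_{nδ-α_i} has a
generator y_i, normalised so that [f_j,[e_i,y_i]] = a_ji y_j (`exists_nullBasis`). The x_i =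
[e_i,y_i] span g_{nδ}, since nδ - α_0 is not a root. Applying the f_j turns a relation ∑ v_i x_i = 0
into the affine part of Av = 0, so δ is the only possible relation and the dimension is at least 8.
It is exactly 8 because ∑ δ_i x_i = 0 does hold (`sum_deltaVec_smul_eq_zero`): α_i ↦ x_i is
equivariant under the affine Weyl group, which contains an element exchanging α_2 and nδ - α_2. Its
lift swaps the lines of e_2 and y_2, so it scales x_2; comparing the two descriptions makes n ∑ δ_i
x_i a multiple of x_2, and f_2 shows that this multiple is zero. -/

noncomputable section

/-! ### Presentation, universal property and Chevalley involution. -/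

namespace ETen

open CartanMatrix

/-- The image of the generator `E i` in `E₁₀`. -/
def genE (i : Fin 10) : Alg :=
  (LieSubmodule.Quotient.mk (FreeLieAlgebra.of ℂ (Generators.E i)) :
    FreeLieAlgebra ℂ (Generators (Fin 10)) ⧸ Relations.toIdeal ℂ cartanMatrix)

/-- The image of the generator `F i` in `E₁₀`. -/
def genF (i : Fin 10) : Alg :=
  (LieSubmodule.Quotient.mk (FreeLieAlgebra.of ℂ (Generators.F i)) :
    FreeLieAlgebra ℂ (Generators (Fin 10)) ⧸ Relations.toIdeal ℂ cartanMatrix)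

/-- The projection from the free Lie algebra onto `E₁₀`. -/
def proj : FreeLieAlgebra ℂ (Generators (Fin 10)) →ₗ⁅ℂ⁆ Alg where
  toFun x := (LieSubmodule.Quotient.mk x :
    FreeLieAlgebra ℂ (Generators (Fin 10)) ⧸ Relations.toIdeal ℂ cartanMatrix)
  map_add' _ _ := rfl
  map_smul' _ _ := rfl
  map_lie' := rfl

theorem proj_surjective : Function.Surjective proj := Quot.mk_surjective

theorem proj_eq_zero_iff {x : FreeLieAlgebra ℂ (Generators (Fin 10))} :
    proj x = 0 ↔ x ∈ Relations.toIdeal ℂ cartanMatrix :=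
  LieSubmodule.Quotient.mk_eq_zero' (N := Relations.toIdeal ℂ cartanMatrix)

theorem proj_relation {x : FreeLieAlgebra ℂ (Generators (Fin 10))}
    (hx : x ∈ Relations.toSet ℂ cartanMatrix) : proj x = 0 :=
  proj_eq_zero_iff.2 (LieSubmodule.subset_lieSpan hx)

theorem lie_genH_genH (i j : Fin 10) : ⁅genH i, genH j⁆ = 0 :=
  proj_relation (x := Relations.HH ℂ (i, j)) (by
    simp only [Relations.toSet, Set.mem_union]
    exact .inl (.inl (.inl (.inl (.inl ⟨(i, j), rfl⟩)))))

theorem lie_genE_genF (i j : Fin 10) : ⁅genE i, genF j⁆ = if i = j then genH i else 0 := by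
  have h := proj_relation (x := Relations.EF ℂ (i, j)) (by
    simp only [Relations.toSet, Set.mem_union]
    exact .inl (.inl (.inl (.inl (.inr ⟨(i, j), rfl⟩)))))
  simp only [Relations.EF, Function.uncurry] at h
  split_ifs with hij
  · subst hij
    rw [if_pos rfl, map_sub, LieHom.map_lie, sub_eq_zero] at h
    exact h
  · rw [if_neg hij, LieHom.map_lie] at h
    exact h

theorem lie_genH_genE (i j : Fin 10) : ⁅genH i, genE j⁆ = (cartanMatrix i j : ℂ) • genE j := by
  have h := proj_relation (x := Relations.HE ℂ cartanMatrix (i, j)) (by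
    simp only [Relations.toSet, Set.mem_union]; exact .inl (.inl (.inl (.inr ⟨(i, j), rfl⟩))))
  simp only [Relations.HE, Function.uncurry] at h
  rw [map_sub, LieHom.map_lie, sub_eq_zero, map_zsmul] at h
  rw [Int.cast_smul_eq_zsmul]
  exact h

theorem lie_genH_genF (i j : Fin 10) : ⁅genH i, genF j⁆ = -(cartanMatrix i j : ℂ) • genF j := by
  have h := proj_relation (x := Relations.HF ℂ cartanMatrix (i, j)) (by
    simp only [Relations.toSet, Set.mem_union]; exact .inl (.inl (.inr ⟨(i, j), rfl⟩)))
  simp only [Relations.HF, Function.uncurry] at h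
  rw [map_add, LieHom.map_lie, map_zsmul, add_eq_zero_iff_eq_neg] at h
  rw [neg_smul, Int.cast_smul_eq_zsmul]
  exact h

theorem map_ad_pow {L L' : Type*} [LieRing L] [LieAlgebra ℂ L] [LieRing L'] [LieAlgebra ℂ L']
    (φ : L →ₗ⁅ℂ⁆ L') (x y : L) (n : ℕ) :
    φ ((LieAlgebra.ad ℂ L x ^ n) y) = (LieAlgebra.ad ℂ L' (φ x) ^ n) (φ y) := by
  induction n with
  | zero => simp
  | succ n ih => simp [pow_succ', ih]

theorem serre_genE (i j : Fin 10) :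
    (LieAlgebra.ad ℂ Alg (genE i) ^ (-cartanMatrix i j).toNat) ⁅genE i, genE j⁆ = 0 := by
  have h := proj_relation (x := Relations.adE ℂ cartanMatrix (i, j)) (by
    simp only [Relations.toSet, Set.mem_union]; exact .inl (.inr ⟨(i, j), rfl⟩))
  simp only [Relations.adE, Function.uncurry] at h
  rw [map_ad_pow, LieHom.map_lie] at h
  exact h

theorem serre_genF (i j : Fin 10) :
    (LieAlgebra.ad ℂ Alg (genF i) ^ (-cartanMatrix i j).toNat) ⁅genF i, genF j⁆ = 0 := by
  have h := proj_relation (x := Relations.adF ℂ cartanMatrix (i, j)) (by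
    simp only [Relations.toSet, Set.mem_union]; exact .inr ⟨(i, j), rfl⟩)
  simp only [Relations.adF, Function.uncurry] at h
  rw [map_ad_pow, LieHom.map_lie] at h
  exact h

/-- The universal property of `E₁₀`. -/
theorem exists_lieHom {L : Type*} [LieRing L] [LieAlgebra ℂ L] (h e f : Fin 10 → L)
    (hh : ∀ i j, ⁅h i, h j⁆ = 0) (ef : ∀ i j, ⁅e i, f j⁆ = if i = j then h i else 0)
    (he : ∀ i j, ⁅h i, e j⁆ = (cartanMatrix i j : ℂ) • e j)
    (hf : ∀ i j, ⁅h i, f j⁆ = -(cartanMatrix i j : ℂ) • f j)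
    (ee : ∀ i j, (LieAlgebra.ad ℂ L (e i) ^ (-cartanMatrix i j).toNat) ⁅e i, e j⁆ = 0)
    (ff : ∀ i j, (LieAlgebra.ad ℂ L (f i) ^ (-cartanMatrix i j).toNat) ⁅f i, f j⁆ = 0) :
    ∃ φ : Alg →ₗ⁅ℂ⁆ L, (∀ i, φ (genH i) = h i) ∧ (∀ i, φ (genE i) = e i) ∧
      ∀ i, φ (genF i) = f i := by
  let g : Generators (Fin 10) → L := fun x => match x with
    | .H i => h i
    | .E i => e i
    | .F i => f i
  let Φ := FreeLieAlgebra.lift ℂ g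
  have gH : ∀ i, Φ (FreeLieAlgebra.of ℂ (.H i)) = h i := fun i => FreeLieAlgebra.lift_of_apply g _
  have gE : ∀ i, Φ (FreeLieAlgebra.of ℂ (.E i)) = e i := fun i => FreeLieAlgebra.lift_of_apply g _
  have gF : ∀ i, Φ (FreeLieAlgebra.of ℂ (.F i)) = f i := fun i => FreeLieAlgebra.lift_of_apply g _
  have key : Relations.toIdeal ℂ cartanMatrix ≤ Φ.ker := by
    rw [Relations.toIdeal, LieSubmodule.lieSpan_le]
    rintro x (((((⟨⟨i, j⟩, rfl⟩ | ⟨⟨i, j⟩, rfl⟩) | ⟨⟨i, j⟩, rfl⟩) | ⟨⟨i, j⟩, rfl⟩) |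
      ⟨⟨i, j⟩, rfl⟩) | ⟨⟨i, j⟩, rfl⟩) <;> rw [SetLike.mem_coe, LieHom.mem_ker]
    · simp [Relations.HH, gH, hh]
    · simp only [Relations.EF, Function.uncurry]
      split_ifs with hij
      · subst hij; simp [gE, gF, gH, ef]
      · simp [gE, gF, ef, hij]
    · simp [Relations.HE, gH, gE, he, Int.cast_smul_eq_zsmul]
    · simp [Relations.HF, gH, gF, hf, Int.cast_smul_eq_zsmul]
    · simp only [Relations.adE, Function.uncurry, map_ad_pow, LieHom.map_lie, Function.comp, gE, ee]
    · simp only [Relations.adF, Function.uncurry, map_ad_pow, LieHom.map_lie, Function.comp, gF, ff]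
  let φ : Alg →ₗ[ℂ] L := Submodule.liftQ (Relations.toIdeal ℂ cartanMatrix).toSubmodule
    (Φ : FreeLieAlgebra ℂ (Generators (Fin 10)) →ₗ[ℂ] L) (fun x hx => key hx)
  have hφ : ∀ x, φ (proj x) = Φ x := fun x => rfl
  refine ⟨{ φ with map_lie' := ?_ }, gH, gE, gF⟩
  intro x y
  obtain ⟨x, rfl⟩ := proj_surjective x
  obtain ⟨y, rfl⟩ := proj_surjective y
  change φ ⁅proj x, proj y⁆ = ⁅φ (proj x), φ (proj y)⁆
  rw [← LieHom.map_lie, hφ, hφ, hφ, LieHom.map_lie]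

/-- A Lie subalgebra that contains the generators is everything. -/
theorem mem_of_generators (K : LieSubalgebra ℂ Alg) (hH : ∀ i, genH i ∈ K) (hE : ∀ i, genE i ∈ K)
    (hF : ∀ i, genF i ∈ K) (x : Alg) : x ∈ K := by
  let g : Generators (Fin 10) → K := fun x => match x with
    | .H i => ⟨genH i, hH i⟩
    | .E i => ⟨genE i, hE i⟩
    | .F i => ⟨genF i, hF i⟩
  have h : K.incl.comp (FreeLieAlgebra.lift ℂ g) = proj := by
    apply FreeLieAlgebra.hom_ext
    rintro (i | i | i) <;> rw [LieHom.comp_apply, FreeLieAlgebra.lift_of_apply] <;> rfl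
  obtain ⟨y, rfl⟩ := proj_surjective x
  rw [← h]
  exact (FreeLieAlgebra.lift ℂ g y).2

theorem lieHom_ext {L : Type*} [LieRing L] [LieAlgebra ℂ L] {φ ψ : Alg →ₗ⁅ℂ⁆ L}
    (hH : ∀ i, φ (genH i) = ψ (genH i)) (hE : ∀ i, φ (genE i) = ψ (genE i))
    (hF : ∀ i, φ (genF i) = ψ (genF i)) : φ = ψ := by
  have h : φ.comp proj = ψ.comp proj := by
    apply FreeLieAlgebra.hom_ext
    rintro (i | i | i)
    exacts [hH i, hE i, hF i]
  ext x
  obtain ⟨y, rfl⟩ := proj_surjective x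
  exact LieHom.congr_fun h y

theorem exists_chevalley : ∃ ω : Alg ≃ₗ⁅ℂ⁆ Alg, (∀ i, ω (genH i) = -genH i) ∧
    (∀ i, ω (genE i) = -genF i) ∧ ∀ i, ω (genF i) = -genE i := by
  have neg_pow : ∀ (x y : Alg) (n : ℕ), (LieAlgebra.ad ℂ Alg x ^ n) y = 0 →
      (LieAlgebra.ad ℂ Alg (-x) ^ n) y = 0 := by
    intro x y n h
    rw [map_neg, neg_pow]
    simp [h]
  obtain ⟨φ, hH, hE, hF⟩ := exists_lieHom (L := Alg) (fun i => -genH i) (fun i => -genF i)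
    (fun i => -genE i) (fun i j => by simp [lie_genH_genH])
    (fun i j => by
      rw [neg_lie, lie_neg, neg_neg, ← lie_skew, lie_genE_genF]
      by_cases h : i = j
      · subst h; simp
      · simp [h, Ne.symm h])
    (fun i j => by simp [lie_genH_genF]) (fun i j => by simp [lie_genH_genE])
    (fun i j => neg_pow _ _ _ (by simp [serre_genF]))
    (fun i j => neg_pow _ _ _ (by simp [serre_genE]))
  have h2 : φ.comp φ = 1 := lieHom_ext (fun i => by simp [hH]) (fun i => by simp [hE, hF])
    (fun i => by simp [hE, hF])
  exact ⟨{ φ with invFun := φ, left_inv := LieHom.congr_fun h2, right_inv := LieHom.congr_fun h2 },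
    hH, hE, hF⟩

end ETen

/-! ### Nonvanishing of the generators, by a highest weight module. -/

namespace ETen

attribute [local instance] LieRing.ofAssociativeRing

/-- The space on which a coinduced module of highest weight `ρ` is realised: a function on words is
a vector `φ`, its value at `i₁ i₂ …` being the vacuum coefficient of `… e_{i₂} e_{i₁} φ`. -/
abbrev WordModule : Type := List (Fin 10) → ℂ

/-- The weight of a word with respect to the `j`-th simple coroot, relative to `ρ`. -/
def wordWeight (j : Fin 10) (l : List (Fin 10)) : ℂ :=
  -- The 1 is ρ(α_j^∨); it makes every h_j fix the vacuum.
  1 - (l.map fun i => (cartanMatrix j i : ℂ)).sum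

theorem wordWeight_cons (j i : Fin 10) (l : List (Fin 10)) :
    wordWeight j (i :: l) = wordWeight j l - cartanMatrix j i := by
  simp [wordWeight]; ring

/-- The action of `E i` on the word module. -/
def wordE (i : Fin 10) : Module.End ℂ WordModule where
  toFun φ l := φ (i :: l)
  map_add' _ _ := rfl
  map_smul' _ _ := rfl

/-- The action of `H j` on the word module. -/
def wordH (j : Fin 10) : Module.End ℂ WordModule where
  toFun φ l := wordWeight j l * φ l
  map_add' _ _ := by ext; simp [mul_add]
  map_smul' _ _ := by ext; simp [mul_left_comm]

/-- The value at a word of the action of `F j`. -/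
def wordFAux (j : Fin 10) : List (Fin 10) → WordModule → ℂ
  -- The value at `i :: l` is forced by e_i f_j = f_j e_i + δ_ij h_i; the value 0 at `[]` says that
  -- the image of f_j has no vacuum coefficient.
  | [], _ => 0
  | i :: l, φ => wordFAux j l (wordE i φ) + if i = j then wordH j φ l else 0

/-- The action of `F j` on the word module. -/
def wordF (j : Fin 10) : Module.End ℂ WordModule where
  toFun φ l := wordFAux j l φ
  map_add' φ ψ := by
    ext l
    induction l generalizing φ ψ with
    | nil => simp [wordFAux]
    | cons i l ih =>
      have := ih (wordE i φ) (wordE i ψ)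
      simp only [Pi.add_apply] at this
      simp only [wordFAux, map_add, this, Pi.add_apply]
      split_ifs <;> ring
  map_smul' c φ := by
    ext l
    induction l generalizing φ with
    | nil => simp [wordFAux]
    | cons i l ih =>
      have := ih (wordE i φ)
      simp only [Pi.smul_apply, RingHom.id_apply, smul_eq_mul] at this
      simp only [wordFAux, map_smul, this, Pi.smul_apply, RingHom.id_apply, smul_eq_mul]
      split_ifs <;> ring

theorem wordF_nil (j : Fin 10) (φ : WordModule) : wordF j φ [] = 0 := rfl

theorem wordE_apply (i : Fin 10) (φ : WordModule) (l : List (Fin 10)) :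
    wordE i φ l = φ (i :: l) := rfl

theorem wordH_apply (i : Fin 10) (φ : WordModule) (l : List (Fin 10)) :
    wordH i φ l = wordWeight i l * φ l := rfl

theorem wordF_cons (i j : Fin 10) (φ : WordModule) (l : List (Fin 10)) :
    wordF j φ (i :: l) = wordF j (wordE i φ) l + if i = j then wordH j φ l else 0 := rfl

theorem lie_wordH_wordH (i j : Fin 10) : ⁅wordH i, wordH j⁆ = 0 := by
  ext φ l
  simp [Ring.lie_def, wordH_apply]; ring

theorem lie_wordE_wordF (i j : Fin 10) : ⁅wordE i, wordF j⁆ = if i = j then wordH i else 0 := by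
  refine LinearMap.ext fun φ => funext fun l => ?_
  rw [Ring.lie_def, LinearMap.sub_apply, Module.End.mul_apply, Module.End.mul_apply, Pi.sub_apply,
    wordE_apply, wordF_cons]
  split_ifs with h
  · subst h; ring
  · simp

theorem lie_wordH_wordE (i j : Fin 10) : ⁅wordH i, wordE j⁆ = (cartanMatrix i j : ℂ) • wordE j := by
  refine LinearMap.ext fun φ => funext fun l => ?_
  rw [Ring.lie_def, LinearMap.sub_apply, Module.End.mul_apply, Module.End.mul_apply, Pi.sub_apply,
    wordE_apply, wordH_apply, wordH_apply, wordE_apply, wordWeight_cons, LinearMap.smul_apply,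
    Pi.smul_apply, wordE_apply, smul_eq_mul]
  ring

theorem lie_wordH_wordF (i j : Fin 10) :
    ⁅wordH i, wordF j⁆ = -(cartanMatrix i j : ℂ) • wordF j := by
  refine LinearMap.ext fun φ => funext fun l => ?_
  rw [Ring.lie_def, LinearMap.sub_apply, Module.End.mul_apply, Module.End.mul_apply, Pi.sub_apply,
    LinearMap.smul_apply, Pi.smul_apply, smul_eq_mul, wordH_apply]
  induction l generalizing φ with
  | nil => simp [wordF_nil]
  | cons k l ih =>
    have h := ih (wordE k φ)
    have h2 : wordE k (wordH i φ) =
        wordH i (wordE k φ) - (cartanMatrix i k : ℂ) • wordE k φ := by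
      have := LinearMap.congr_fun (lie_wordH_wordE i k) φ
      rw [Ring.lie_def, LinearMap.sub_apply, Module.End.mul_apply, Module.End.mul_apply,
        LinearMap.smul_apply] at this
      rw [← this]; abel
    rw [wordF_cons, wordF_cons, wordWeight_cons, h2, map_sub, map_smul, Pi.sub_apply, Pi.smul_apply,
      smul_eq_mul]
    by_cases hk : k = j
    · subst hk
      simp only [if_true, wordH_apply]
      linear_combination h
    · simp only [if_neg hk]
      linear_combination h

theorem cartanMatrix_self (i : Fin 10) : cartanMatrix i i = 2 := by
  revert i; decide

theorem cartanMatrix_comm (i j : Fin 10) : cartanMatrix i j = cartanMatrix j i := by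
  have h : ∀ i j, cartanMatrix i j - cartanMatrix j i = 0 := by decide
  exact sub_eq_zero.1 (h i j)

theorem cartanMatrix_trichotomy (i j : Fin 10) : (i = j ∧ cartanMatrix i j = 2) ∨
    (i ≠ j ∧ cartanMatrix i j = 0 ∧ cartanMatrix j i = 0) ∨
    (i ≠ j ∧ cartanMatrix i j = -1 ∧ cartanMatrix j i = -1) := by
  have h : ∀ i j : Fin 10, i = j ∨ cartanMatrix i j + 0 = 0 ∨ cartanMatrix i j + 0 = -1 := by
    decide
  simp only [add_zero] at h
  rw [cartanMatrix_comm j i]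
  by_cases hij : i = j
  · subst hij; exact .inl ⟨rfl, cartanMatrix_self i⟩
  · rcases h i j with h | h | h
    exacts [(hij h).elim, .inr (.inl ⟨hij, h, h⟩), .inr (.inr ⟨hij, h, h⟩)]

/-- The Serre elements in the `f i` commute with the `e k`. -/
theorem lie_serre_eq_zero {L : Type*} [LieRing L] [LieAlgebra ℂ L] (h e f : Fin 10 → L)
    (ef : ∀ i j, ⁅e i, f j⁆ = if i = j then h i else 0)
    (hf : ∀ i j, ⁅h i, f j⁆ = -(cartanMatrix i j : ℂ) • f j) (i j k : Fin 10) :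
    ⁅e k, (LieAlgebra.ad ℂ L (f i) ^ (-cartanMatrix i j).toNat) ⁅f i, f j⁆⁆ = 0 := by
  have h1 : ⁅e k, ⁅f i, f j⁆⁆ = (if k = i then -(cartanMatrix i j : ℂ) • f j else 0) +
      if k = j then (cartanMatrix j i : ℂ) • f i else 0 := by
    rw [leibniz_lie, ef, ef]
    congr 1
    · split_ifs with hk
      · subst hk; rw [hf]
      · simp
    · split_ifs with hk
      · subst hk; rw [← lie_skew, hf, neg_smul, neg_neg]
      · simp
  -- On the diagonal the element is a power of ad f_i on ⁅f i, f i⁆ = 0; elsewhere the exponent is 0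
  -- or 1.
  obtain ⟨rfl, ha⟩ | ⟨-, ha, hb⟩ | ⟨hij, ha, hb⟩ := cartanMatrix_trichotomy i j
  · simp
  · simp [ha, hb, h1]
  · have h2 : (-cartanMatrix i j).toNat = 1 := by simp [ha]
    rw [h2, pow_one, LieAlgebra.ad_apply, leibniz_lie, h1, ef]
    by_cases hk : k = i
    · subst hk
      rw [if_pos rfl, if_pos rfl, if_neg hij, leibniz_lie, hf, hf]
      simp only [ha, cartanMatrix_self, smul_lie, lie_smul, add_zero]
      push_cast
      module
    · simp only [if_neg hk, zero_lie, zero_add]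
      split_ifs <;> simp

/-- A Serre element θ commutes with every e_k, so the value of θφ at a word is the value at `[]` of
θ applied to a shifted φ. That value is zero, because every term of θ has some f as its leftmost
factor. -/
theorem wordF_serre (i j : Fin 10) : (LieAlgebra.ad ℂ (Module.End ℂ WordModule) (wordF i) ^
    (-cartanMatrix i j).toNat) ⁅wordF i, wordF j⁆ = 0 := by
  have hc := lie_serre_eq_zero wordH wordE wordF lie_wordE_wordF lie_wordH_wordF i j
  have h0 : ∀ φ, ((LieAlgebra.ad ℂ (Module.End ℂ WordModule) (wordF i) ^
      (-cartanMatrix i j).toNat) ⁅wordF i, wordF j⁆) φ [] = 0 := by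
    intro φ
    obtain ⟨rfl, ha⟩ | ⟨-, ha, hb⟩ | ⟨hij, ha, hb⟩ := cartanMatrix_trichotomy i j
    · simp
    · simp [ha, Ring.lie_def, wordF_nil]
    · simp [ha, Ring.lie_def, wordF_nil]
  generalize (LieAlgebra.ad ℂ (Module.End ℂ WordModule) (wordF i) ^
    (-cartanMatrix i j).toNat) ⁅wordF i, wordF j⁆ = θ at hc h0
  refine LinearMap.ext fun φ => funext fun l => ?_
  induction l generalizing φ with
  | nil => exact h0 φ
  | cons k l ih =>
    have := LinearMap.congr_fun (hc k) φ
    rw [Ring.lie_def, LinearMap.sub_apply, Module.End.mul_apply, Module.End.mul_apply,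
      LinearMap.zero_apply, sub_eq_zero] at this
    rw [← wordE_apply k (θ φ), this, ih]
    rfl

/-- The vacuum vector of the word module. -/
def vacuum : WordModule := fun l => if l = [] then 1 else 0

theorem wordE_vacuum (i : Fin 10) : wordE i vacuum = 0 := by
  ext l; simp [wordE_apply, vacuum]

theorem wordH_vacuum (i : Fin 10) : wordH i vacuum = vacuum := by
  ext l
  by_cases h : l = [] <;> simp [wordH_apply, vacuum, wordWeight, h]

/-- The monomials in the `F j`, applied to the vacuum. -/
def monomial : List (Fin 10) → WordModule
  | [] => vacuum
  | j :: l => wordF j (monomial l)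

/-- The submodule generated by the vacuum. -/
def vacuumModule : Submodule ℂ WordModule := Submodule.span ℂ (Set.range monomial)

theorem monomial_mem (l : List (Fin 10)) : monomial l ∈ vacuumModule :=
  Submodule.subset_span ⟨l, rfl⟩

theorem vacuumModule_mapsTo (x : Module.End ℂ WordModule)
    (hx : ∀ l, x (monomial l) ∈ vacuumModule) : ∀ φ ∈ vacuumModule, x φ ∈ vacuumModule := by
  intro φ hφ
  induction hφ using Submodule.span_induction with
  | mem _ h => obtain ⟨l, rfl⟩ := h; exact hx l
  | zero => simp
  | add _ _ _ _ h h' => rw [map_add]; exact add_mem h h'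
  | smul c _ _ h => rw [map_smul]; exact Submodule.smul_mem _ c h

theorem wordF_mem (i : Fin 10) : ∀ φ ∈ vacuumModule, wordF i φ ∈ vacuumModule :=
  vacuumModule_mapsTo _ fun l => monomial_mem (i :: l)

theorem wordH_mem (i : Fin 10) : ∀ φ ∈ vacuumModule, wordH i φ ∈ vacuumModule := by
  refine vacuumModule_mapsTo _ fun l => ?_
  induction l with
  | nil => rw [monomial, wordH_vacuum]; exact monomial_mem []
  | cons j l ih =>
    have := LinearMap.congr_fun (lie_wordH_wordF i j) (monomial l)
    rw [Ring.lie_def, LinearMap.sub_apply, Module.End.mul_apply, Module.End.mul_apply,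
      sub_eq_iff_eq_add] at this
    rw [monomial, this]
    exact add_mem (Submodule.smul_mem _ _ (monomial_mem (j :: l))) (wordF_mem _ _ ih)

theorem wordE_mem (i : Fin 10) : ∀ φ ∈ vacuumModule, wordE i φ ∈ vacuumModule := by
  refine vacuumModule_mapsTo _ fun l => ?_
  induction l with
  | nil => rw [monomial, wordE_vacuum]; exact zero_mem _
  | cons j l ih =>
    have := LinearMap.congr_fun (lie_wordE_wordF i j) (monomial l)
    rw [Ring.lie_def, LinearMap.sub_apply, Module.End.mul_apply, Module.End.mul_apply,
      sub_eq_iff_eq_add] at this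
    rw [monomial, this]
    refine add_mem ?_ (wordF_mem _ _ ih)
    split_ifs
    · exact wordH_mem _ _ (monomial_mem l)
    · exact zero_mem _

/-- On all of `WordModule` the e_i act freely, so this relation needs the submodule generated by the
vacuum: the Serre element kills the vacuum and commutes with every f_k, hence kills all monomials.
-/
theorem wordE_serre (i j : Fin 10) : ∀ φ ∈ vacuumModule,
    ((LieAlgebra.ad ℂ (Module.End ℂ WordModule) (wordE i) ^
      (-cartanMatrix i j).toNat) ⁅wordE i, wordE j⁆) φ = 0 := by
  have hc := lie_serre_eq_zero (fun i => -wordH i) wordF wordE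
    (fun i j => by
      rw [← lie_skew, lie_wordE_wordF]
      by_cases h : i = j
      · subst h; simp
      · simp [h, Ne.symm h])
    (fun i j => by rw [neg_lie, lie_wordH_wordE, neg_smul]) i j
  have h0 : ((LieAlgebra.ad ℂ (Module.End ℂ WordModule) (wordE i) ^
      (-cartanMatrix i j).toNat) ⁅wordE i, wordE j⁆) vacuum = 0 := by
    obtain ⟨rfl, ha⟩ | ⟨-, ha, hb⟩ | ⟨hij, ha, hb⟩ := cartanMatrix_trichotomy i j
    · simp
    · simp [ha, Ring.lie_def, wordE_vacuum]
    · simp [ha, Ring.lie_def, wordE_vacuum]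
  generalize (LieAlgebra.ad ℂ (Module.End ℂ WordModule) (wordE i) ^
    (-cartanMatrix i j).toNat) ⁅wordE i, wordE j⁆ = θ at hc h0
  intro φ hφ
  induction hφ using Submodule.span_induction with
  | mem _ h =>
    obtain ⟨l, rfl⟩ := h
    induction l with
    | nil => exact h0
    | cons k l ih =>
      have := LinearMap.congr_fun (hc k) (monomial l)
      rw [Ring.lie_def, LinearMap.sub_apply, Module.End.mul_apply, Module.End.mul_apply,
        LinearMap.zero_apply, sub_eq_zero] at this
      rw [monomial, ← this, ih, map_zero]
  | zero => simp
  | add _ _ _ _ h h' => rw [map_add, h, h', add_zero]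
  | smul c _ _ h => rw [map_smul, h, smul_zero]

/-- The algebra acts on `vacuumModule`, and there h_i fixes the nonzero vacuum. -/
theorem genH_ne_zero (i : Fin 10) : genH i ≠ 0 := by
  let r : (x : Module.End ℂ WordModule) → (∀ φ ∈ vacuumModule, x φ ∈ vacuumModule) →
    Module.End ℂ vacuumModule := fun x hx => x.restrict hx
  have hadd : ∀ (x y : Module.End ℂ WordModule) hx hy,
      ∃ hxy, ⁅r x hx, r y hy⁆ = r ⁅x, y⁆ hxy := fun x y hx hy =>
    ⟨fun φ hφ => by
      rw [Ring.lie_def, LinearMap.sub_apply]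
      exact sub_mem (hx _ (hy _ hφ)) (hy _ (hx _ hφ)), rfl⟩
  have hpow : ∀ (n : ℕ) (x y : Module.End ℂ WordModule) hx hy, ∃ hxy,
      (LieAlgebra.ad ℂ _ (r x hx) ^ n) (r y hy) = r ((LieAlgebra.ad ℂ _ x ^ n) y) hxy := by
    intro n x y hx hy
    induction n with
    | zero => exact ⟨hy, rfl⟩
    | succ n ih =>
      obtain ⟨hxy, h⟩ := ih
      obtain ⟨hxy', h'⟩ := hadd x _ hx hxy
      simp only [pow_succ', Module.End.mul_apply, h, LieAlgebra.ad_apply, h']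
      exact ⟨hxy', trivial⟩
  have serre : ∀ (n : ℕ) (x y : Module.End ℂ WordModule) hx hy,
      (∀ φ ∈ vacuumModule, ((LieAlgebra.ad ℂ _ x ^ n) ⁅x, y⁆) φ = 0) →
      (LieAlgebra.ad ℂ _ (r x hx) ^ n) ⁅r x hx, r y hy⁆ = 0 := by
    intro n x y hx hy h
    obtain ⟨h1, h2⟩ := hadd x y hx hy
    obtain ⟨h3, h4⟩ := hpow n x _ hx h1
    rw [h2, h4]
    exact LinearMap.ext fun φ => Subtype.ext (h φ φ.2)
  have ext : ∀ (x y z : Module.End ℂ WordModule) hx hy hz, ⁅x, y⁆ = z →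
      ⁅r x hx, r y hy⁆ = r z hz := by
    rintro x y _ hx hy hz rfl
    exact (hadd x y hx hy).2
  obtain ⟨φ, hH, -, -⟩ := exists_lieHom (L := Module.End ℂ vacuumModule)
    (fun i => r (wordH i) (wordH_mem i)) (fun i => r (wordE i) (wordE_mem i))
    (fun i => r (wordF i) (wordF_mem i))
    (fun i j => ext _ _ 0 _ _ (fun _ _ => zero_mem _) (lie_wordH_wordH i j))
    (fun i j => by
      split_ifs with h
      · exact ext _ _ _ _ _ _ (by rw [lie_wordE_wordF, if_pos h])
      · exact ext _ _ 0 _ _ (fun _ _ => zero_mem _) (by rw [lie_wordE_wordF, if_neg h]))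
    (fun i j => ext _ _ _ _ _ (fun φ hφ => Submodule.smul_mem _ _ (wordE_mem j φ hφ))
      (lie_wordH_wordE i j))
    (fun i j => ext _ _ _ _ _ (fun φ hφ => Submodule.smul_mem _ _ (wordF_mem j φ hφ))
      (lie_wordH_wordF i j))
    (fun i j => serre _ _ _ _ _ (wordE_serre i j))
    (fun i j => serre _ _ _ _ _ fun φ _ => by rw [wordF_serre]; rfl)
  intro h0
  have h1 := hH i
  rw [h0, map_zero] at h1
  have h2 := congrArg Subtype.val (LinearMap.congr_fun h1 ⟨vacuum, monomial_mem []⟩)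
  have h3 : wordH i vacuum = 0 := h2.symm
  rw [wordH_vacuum] at h3
  have := congrFun h3 []
  simp [vacuum] at this

theorem genE_ne_zero (i : Fin 10) : genE i ≠ 0 := by
  intro h
  have := lie_genE_genF i i
  rw [h, zero_lie, if_pos rfl] at this
  exact genH_ne_zero i this.symm

end ETen

/-! ### Root spaces and the triangular decomposition. -/

namespace ETen

attribute [local instance] LieRing.ofAssociativeRing

theorem mem_rootSpace {α : Module.Dual ℝ Cartan} {x : Alg} :
    x ∈ rootSpace α ↔ ∀ i, ⁅genH i, x⁆ = ((α (coroot i) : ℝ) : ℂ) • x := by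
  have htoAlg : ∀ i, toAlg (coroot i) = genH i := fun i => by
    rw [toAlg, Finset.sum_eq_single i]
    · simp [coroot]
    · intro j _ hj; simp [coroot, hj]
    · simp
  constructor
  · intro h i
    rw [← htoAlg]; exact h _
  · intro h t
    have ht : t = ∑ i, t i • coroot i := by
      ext j; simp [coroot, Pi.single_apply]
    rw [toAlg, sum_lie]
    simp only [smul_lie, h, smul_smul]
    rw [← Finset.sum_smul]
    congr 1
    conv_rhs => rw [ht, map_sum]
    push_cast
    simp

theorem lie_mem_rootSpace {α β : Module.Dual ℝ Cartan} {x y : Alg} (hx : x ∈ rootSpace α)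
    (hy : y ∈ rootSpace β) : ⁅x, y⁆ ∈ rootSpace (α + β) := by
  rw [mem_rootSpace] at *
  intro i
  rw [leibniz_lie, hx, hy, smul_lie, lie_smul, LinearMap.add_apply, ← add_smul]
  push_cast
  rfl

/-- The element of the root lattice with given coordinates. -/
def root : (Fin 10 → ℤ) →+ Module.Dual ℝ Cartan where
  toFun c := ∑ j, (c j : ℝ) • simpleRoot j
  map_zero' := by simp
  map_add' c d := by simp [add_smul, Finset.sum_add_distrib]

theorem root_apply (c : Fin 10 → ℤ) : root c = ∑ j, (c j : ℝ) • simpleRoot j := rfl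

theorem root_single (i : Fin 10) : root (Pi.single i 1) = simpleRoot i := by
  rw [root_apply, Finset.sum_eq_single i]
  · simp
  · intro j _ hj; simp [hj]
  · simp

theorem root_injective : Function.Injective root := by
  intro c d h
  rw [root_apply, root_apply] at h
  have := linearIndependent_simpleRoot.fintypeLinearCombination_injective (a₁ := fun i => (c i : ℝ))
    (a₂ := fun i => (d i : ℝ)) (by simpa [Fintype.linearCombination_apply] using h)
  ext i
  exact_mod_cast congrFun this i

/-- The pairing of an element of the root lattice with a simple coroot. -/
def pairing (c : Fin 10 → ℤ) (i : Fin 10) : ℤ := ∑ j, cartanMatrix i j * c j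

theorem root_coroot (c : Fin 10 → ℤ) (i : Fin 10) : root c (coroot i) = pairing c i := by
  simp [root_apply, pairing, simpleRoot_coroot, mul_comm]

theorem pairing_add (c d : Fin 10 → ℤ) (i : Fin 10) :
    pairing (c + d) i = pairing c i + pairing d i := by
  simp [pairing, mul_add, Finset.sum_add_distrib]

theorem pairing_neg (c : Fin 10 → ℤ) (i : Fin 10) : pairing (-c) i = -pairing c i := by
  simp [pairing]

theorem pairing_sub (c d : Fin 10 → ℤ) (i : Fin 10) :
    pairing (c - d) i = pairing c i - pairing d i := by
  rw [sub_eq_add_neg, pairing_add, pairing_neg, sub_eq_add_neg]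

theorem pairing_zsmul (n : ℤ) (c : Fin 10 → ℤ) (i : Fin 10) :
    pairing (n • c) i = n * pairing c i := by
  simp [pairing, Finset.mul_sum, mul_left_comm]

theorem pairing_single (i j : Fin 10) : pairing (Pi.single j 1) i = cartanMatrix i j := by
  simp [pairing, Pi.single_apply]

/-- The root space of an element of the root lattice. -/
abbrev gs (c : Fin 10 → ℤ) : Submodule ℂ Alg := rootSpace (root c)

theorem mem_gs {c : Fin 10 → ℤ} {x : Alg} :
    x ∈ gs c ↔ ∀ i, ⁅genH i, x⁆ = (pairing c i : ℂ) • x := by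
  simp [mem_rootSpace, root_coroot]

theorem lie_mem_gs {c d : Fin 10 → ℤ} {x y : Alg} (hx : x ∈ gs c) (hy : y ∈ gs d) :
    ⁅x, y⁆ ∈ gs (c + d) := by
  rw [gs, map_add]; exact lie_mem_rootSpace hx hy

theorem genE_mem_gs (i : Fin 10) : genE i ∈ gs (Pi.single i 1) :=
  mem_gs.2 fun j => by rw [lie_genH_genE, pairing_single]

theorem genF_mem_gs (i : Fin 10) : genF i ∈ gs (-Pi.single i 1) :=
  mem_gs.2 fun j => by rw [lie_genH_genF, pairing_neg, pairing_single]; push_cast; rfl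

theorem genH_mem_gs (i : Fin 10) : genH i ∈ gs 0 :=
  mem_gs.2 fun j => by rw [lie_genH_genH]; simp [pairing]

/-- Root spaces are joint eigenspaces of the commuting operators ad h_i, and a linear form is
determined by its values on the simple coroots. -/
theorem iSupIndep_rootSpace : iSupIndep rootSpace := by
  have h := Module.End.independent_iInf_maxGenEigenspace_of_forall_mapsTo
    (fun i : Fin 10 => LieAlgebra.ad ℂ Alg (genH i)) (fun i j φ =>
      Module.End.mapsTo_maxGenEigenspace_of_comm (by
        rw [Commute, SemiconjBy, ← sub_eq_zero, ← Ring.lie_def]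
        have := (LieAlgebra.ad ℂ Alg).map_lie (genH j) (genH i)
        rw [lie_genH_genH, map_zero] at this
        exact this.symm) φ)
  have hinj : Function.Injective fun (α : Module.Dual ℝ Cartan) (i : Fin 10) =>
      ((α (coroot i) : ℝ) : ℂ) := by
    intro α β hαβ
    refine LinearMap.pi_ext' fun i => LinearMap.ext_ring ?_
    have h1 : ((α (coroot i) : ℝ) : ℂ) = ((β (coroot i) : ℝ) : ℂ) := congrFun hαβ i
    exact Complex.ofReal_injective h1
  refine (h.comp hinj).mono fun α x hx => ?_
  rw [Function.comp_apply, Submodule.mem_iInf]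
  intro i
  exact Module.End.eigenspace_le_maxGenEigenspace
    (Module.End.mem_eigenspace_iff.2 (mem_rootSpace.1 hx i))

theorem weight_unique {α β : Module.Dual ℝ Cartan} {x : Alg} (h0 : x ≠ 0) (hα : x ∈ rootSpace α)
    (hβ : x ∈ rootSpace β) : α = β := by
  by_contra h
  exact h0 (Submodule.disjoint_def.1 (iSupIndep_rootSpace.pairwiseDisjoint h) x hα hβ)

/-- In a decomposition along weight vectors, the components of the other weights cancel by
independence. -/
theorem rootSpace_le_span {X : Set Alg} (hX : ∀ x ∈ X, ∃ α, x ∈ rootSpace α)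
    (htop : Submodule.span ℂ X = ⊤) (α : Module.Dual ℝ Cartan) :
    rootSpace α ≤ Submodule.span ℂ (X ∩ rootSpace α) := by
  intro x hx
  have h1 : x ∈ Submodule.span ℂ (X ∩ rootSpace α) ⊔ ⨆ (β) (_ : β ≠ α), rootSpace β := by
    have h2 : Submodule.span ℂ X ≤
        Submodule.span ℂ (X ∩ rootSpace α) ⊔ ⨆ (β) (_ : β ≠ α), rootSpace β := by
      refine Submodule.span_le.2 fun y hy => ?_
      obtain ⟨β, hβ⟩ := hX y hy
      by_cases h : β = α
      · subst h
        exact Submodule.mem_sup_left (Submodule.subset_span ⟨hy, hβ⟩)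
      · exact Submodule.mem_sup_right (Submodule.mem_iSup_of_mem β (Submodule.mem_iSup_of_mem h hβ))
    exact h2 (htop ▸ Submodule.mem_top)
  obtain ⟨a, ha, b, hb, rfl⟩ := Submodule.mem_sup.1 h1
  have ha' : a ∈ rootSpace α := Submodule.span_le.2 Set.inter_subset_right ha
  have hb' : b ∈ rootSpace α := by simpa using sub_mem hx ha'
  have := Submodule.disjoint_def.1 (iSupIndep_rootSpace α) b hb' hb
  rwa [this, add_zero]

/-- Iterated brackets `[g i₁, [g i₂, …]]`, together with their degrees. -/
inductive IsWord (g : Fin 10 → Alg) : (Fin 10 → ℤ) → Alg → Prop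
  | single (i : Fin 10) : IsWord g (Pi.single i 1) (g i)
  | cons (i : Fin 10) {c : Fin 10 → ℤ} {x : Alg} (h : IsWord g c x) :
      IsWord g (Pi.single i 1 + c) ⁅g i, x⁆

theorem IsWord.nonneg {g : Fin 10 → Alg} {c : Fin 10 → ℤ} {x : Alg} (h : IsWord g c x) : 0 ≤ c := by
  have h1 : ∀ i : Fin 10, (0 : Fin 10 → ℤ) ≤ Pi.single i 1 := fun i => by simp
  induction h with
  | single i => exact h1 i
  | cons i _ ih => exact add_nonneg (h1 i) ih

theorem IsWord.ne_zero {g : Fin 10 → Alg} {c : Fin 10 → ℤ} {x : Alg} (h : IsWord g c x) :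
    c ≠ 0 := by
  cases h with
  | single i => simp
  | @cons i c _ h =>
    intro h0
    have h1 := congrFun h0 i
    have h2 : 0 ≤ c i := h.nonneg i
    simp at h1
    omega

theorem IsWord.mem_gs {c : Fin 10 → ℤ} {x : Alg} (h : IsWord genE c x) : x ∈ gs c := by
  induction h with
  | single i => exact genE_mem_gs i
  | cons i _ ih => exact lie_mem_gs (genE_mem_gs i) ih

theorem IsWord.mem_gs_neg {c : Fin 10 → ℤ} {x : Alg} (h : IsWord genF c x) : x ∈ gs (-c) := by
  induction h with
  | single i => exact genF_mem_gs i
  | cons i _ ih => rw [neg_add]; exact lie_mem_gs (genF_mem_gs i) ih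

/-- The span of the iterated brackets of a family. -/
def wordSpan (g : Fin 10 → Alg) : Submodule ℂ Alg := Submodule.span ℂ {x | ∃ c, IsWord g c x}

theorem IsWord.mem_wordSpan {g : Fin 10 → Alg} {c : Fin 10 → ℤ} {x : Alg} (h : IsWord g c x) :
    x ∈ wordSpan g := Submodule.subset_span ⟨c, h⟩

theorem lie_mem_of_mem_span {X : Set Alg} {M : Submodule ℂ Alg} {y : Alg}
    (h : ∀ x ∈ X, ⁅y, x⁆ ∈ M) : ∀ x ∈ Submodule.span ℂ X, ⁅y, x⁆ ∈ M := fun _ hx =>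
  (Submodule.span_le (p := M.comap (LieAlgebra.ad ℂ Alg y))).2 h hx

theorem lie_wordSpan_self (g : Fin 10 → Alg) (i : Fin 10) :
    ∀ x ∈ wordSpan g, ⁅g i, x⁆ ∈ wordSpan g :=
  lie_mem_of_mem_span fun _ ⟨_, h⟩ => (h.cons i).mem_wordSpan

/-- Induction on the word by the Jacobi identity; a Cartan term produced inside falls back into the
word span once it is bracketed with the next letter. The abstract e, f, h, a let it serve both
signs. -/
theorem lie_wordSpan_opposite (e f h : Fin 10 → Alg) (a : Fin 10 → Fin 10 → ℂ)
    (ef : ∀ i j, ⁅e i, f j⁆ = if i = j then h i else 0) (hf : ∀ i j, ⁅h i, f j⁆ = a i j • f j)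
    (i : Fin 10) :
    ∀ x ∈ wordSpan f, ⁅e i, x⁆ ∈ wordSpan f ⊔ Submodule.span ℂ (Set.range h) := by
  have hh : ∀ i, ∀ x ∈ wordSpan f, ⁅h i, x⁆ ∈ wordSpan f := by
    intro i
    refine lie_mem_of_mem_span ?_
    rintro x ⟨c, hx⟩
    induction hx with
    | single j => rw [hf]; exact Submodule.smul_mem _ _ (IsWord.single j).mem_wordSpan
    | cons j hx ih =>
      rw [leibniz_lie, hf, smul_lie]
      exact add_mem (Submodule.smul_mem _ _ (hx.cons j).mem_wordSpan) (lie_wordSpan_self f j _ ih)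
  refine lie_mem_of_mem_span ?_
  rintro x ⟨c, hx⟩
  induction hx with
  | single j =>
    rw [ef]
    split_ifs
    · exact Submodule.mem_sup_right (Submodule.subset_span ⟨i, rfl⟩)
    · exact zero_mem _
  | @cons j c x hx ih =>
    rw [leibniz_lie, ef]
    refine add_mem ?_ ?_
    · split_ifs
      · exact Submodule.mem_sup_left (hh _ _ hx.mem_wordSpan)
      · rw [zero_lie]; exact zero_mem _
    · obtain ⟨y, hy, z, hz, hyz⟩ := Submodule.mem_sup.1 ih
      rw [← hyz, lie_add]
      refine Submodule.mem_sup_left (add_mem (lie_wordSpan_self f j _ hy) ?_)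
      refine lie_mem_of_mem_span ?_ z hz
      rintro _ ⟨k, rfl⟩
      rw [← lie_skew, hf]
      exact neg_mem (Submodule.smul_mem _ _ (IsWord.single j).mem_wordSpan)

/-- The generating set given by the triangular decomposition. -/
def triangularSet : Set Alg :=
  {x | ∃ c, IsWord genE c x} ∪ {x | ∃ c, IsWord genF c x} ∪ Set.range genH

/-- The span S is stable under each e_i and f_i, hence under h_i = [e_i,f_i]. The elements that
stabilise S form a subalgebra, so they are everything; thus S is itself a subalgebra, and it
contains the generators. -/
theorem span_triangularSet : Submodule.span ℂ triangularSet = ⊤ := by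
  set S := Submodule.span ℂ triangularSet with hS
  have hEle : wordSpan genE ≤ S :=
    Submodule.span_mono (Set.subset_union_left.trans Set.subset_union_left)
  have hFle : wordSpan genF ≤ S :=
    Submodule.span_mono (Set.subset_union_right.trans Set.subset_union_left)
  have hHle : Submodule.span ℂ (Set.range genH) ≤ S := Submodule.span_mono Set.subset_union_right
  have fe : ∀ i j, ⁅genF i, genE j⁆ = if i = j then -genH i else 0 := fun i j => by
    rw [← lie_skew, lie_genE_genF]
    by_cases h : i = j
    · subst h; simp
    · simp [h, Ne.symm h]
  have hE : ∀ i, ∀ x ∈ S, ⁅genE i, x⁆ ∈ S := by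
    intro i
    apply lie_mem_of_mem_span
    rintro x ((⟨c, hx⟩ | ⟨c, hx⟩) | ⟨j, rfl⟩)
    · exact hEle (hx.cons i).mem_wordSpan
    · exact sup_le hFle hHle (lie_wordSpan_opposite genE genF genH _ lie_genE_genF lie_genH_genF i x
        hx.mem_wordSpan)
    · rw [← lie_skew, lie_genH_genE]
      exact neg_mem (Submodule.smul_mem _ _ (hEle (IsWord.single i).mem_wordSpan))
  have hF : ∀ i, ∀ x ∈ S, ⁅genF i, x⁆ ∈ S := by
    intro i
    apply lie_mem_of_mem_span
    rintro x ((⟨c, hx⟩ | ⟨c, hx⟩) | ⟨j, rfl⟩)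
    · have h1 := lie_wordSpan_opposite genF genE (fun i => -genH i)
        (fun i j => -(cartanMatrix i j : ℂ)) fe
        (fun i j => by rw [neg_lie, lie_genH_genE, neg_smul]) i x hx.mem_wordSpan
      refine sup_le hEle ?_ h1
      rw [Submodule.span_le]
      rintro _ ⟨k, rfl⟩
      exact neg_mem (hHle (Submodule.subset_span ⟨k, rfl⟩))
    · exact hFle (hx.cons i).mem_wordSpan
    · rw [← lie_skew, lie_genH_genF]
      exact neg_mem (Submodule.smul_mem _ _ (hFle (IsWord.single i).mem_wordSpan))
  have hH : ∀ i, ∀ x ∈ S, ⁅genH i, x⁆ ∈ S := by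
    intro i x hx
    have := lie_genE_genF i i
    rw [if_pos rfl] at this
    rw [← this, lie_lie]
    exact sub_mem (hE _ _ (hF _ _ hx)) (hF _ _ (hE _ _ hx))
  let N : LieSubalgebra ℂ Alg :=
    { carrier := {y | ∀ x ∈ S, ⁅y, x⁆ ∈ S}
      add_mem' := fun {a b} ha hb x hx => by rw [add_lie]; exact add_mem (ha x hx) (hb x hx)
      zero_mem' := fun x _ => by rw [zero_lie]; exact zero_mem _
      smul_mem' := fun c a ha x hx => by rw [smul_lie]; exact Submodule.smul_mem _ _ (ha x hx)
      lie_mem' := fun {a b} ha hb x hx => by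
        rw [lie_lie]; exact sub_mem (ha _ (hb x hx)) (hb _ (ha x hx)) }
  have hN : ∀ y, ∀ x ∈ S, ⁅y, x⁆ ∈ S := fun y => mem_of_generators N hH hE hF y
  let K : LieSubalgebra ℂ Alg := { S with lie_mem' := fun {a b} _ hb => hN a b hb }
  refine eq_top_iff.2 fun x _ => mem_of_generators K (fun i => ?_) (fun i => ?_) (fun i => ?_) x
  · exact hHle (Submodule.subset_span ⟨i, rfl⟩)
  · exact hEle (IsWord.single i).mem_wordSpan
  · exact hFle (IsWord.single i).mem_wordSpan

theorem exists_mem_rootSpace {x : Alg} (hx : x ∈ triangularSet) : ∃ α, x ∈ rootSpace α := by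
  rcases hx with (⟨c, hx⟩ | ⟨c, hx⟩) | ⟨j, rfl⟩
  exacts [⟨_, hx.mem_gs⟩, ⟨_, hx.mem_gs_neg⟩, ⟨_, genH_mem_gs j⟩]

/-- The roots are integral, and either positive or negative. -/
theorem root_cases {α : Module.Dual ℝ Cartan} (h : rootSpace α ≠ ⊥) (h0 : α ≠ 0) :
    ∃ c, 0 ≤ c ∧ c ≠ 0 ∧ (α = root c ∨ α = root (-c)) := by
  by_contra! hc
  refine h (eq_bot_iff.2 ((rootSpace_le_span (fun _ => exists_mem_rootSpace)
    span_triangularSet α).trans ?_))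
  rw [Submodule.span_le]
  rintro x ⟨(⟨c, hx⟩ | ⟨c, hx⟩) | ⟨j, rfl⟩, hxα⟩
  · by_contra hx0
    exact (hc c hx.nonneg hx.ne_zero).1 (weight_unique hx0 hxα hx.mem_gs)
  · by_contra hx0
    exact (hc c hx.nonneg hx.ne_zero).2 (weight_unique hx0 hxα hx.mem_gs_neg)
  · exact (h0 (by simpa using weight_unique (genH_ne_zero j) hxα (genH_mem_gs j))).elim

theorem gs_le_of_words {c : Fin 10 → ℤ} (hc : 0 ≤ c) (h0 : c ≠ 0) {M : Submodule ℂ Alg}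
    (h : ∀ x, IsWord genE c x → x ∈ M) : gs c ≤ M := by
  refine (rootSpace_le_span (fun _ => exists_mem_rootSpace) span_triangularSet (root c)).trans ?_
  rw [Submodule.span_le]
  rintro x ⟨(⟨d, hx⟩ | ⟨d, hx⟩) | ⟨j, rfl⟩, hxα⟩
  · by_cases hx0 : x = 0
    · rw [hx0]; exact zero_mem _
    · have := root_injective (weight_unique hx0 hxα hx.mem_gs)
      subst this
      exact h x hx
  · by_cases hx0 : x = 0
    · rw [hx0]; exact zero_mem _
    · have := root_injective (weight_unique hx0 hxα hx.mem_gs_neg)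
      subst this
      exact (hx.ne_zero (le_antisymm (neg_nonneg.1 hc) hx.nonneg)).elim
  · exact (h0 (root_injective (weight_unique (genH_ne_zero j) hxα (genH_mem_gs j)))).elim

/-- Such a word has i as its only letter, and [e_i,e_i] = 0 kills it as soon as it has two letters.
-/
theorem isWord_multiple {c : Fin 10 → ℤ} {x : Alg} (h : IsWord genE c x) (i : Fin 10) (k : ℤ)
    (hc : c = k • Pi.single i 1) : (k = 1 ∧ x = genE i) ∨ x = 0 := by
  induction h generalizing k with
  | single j =>
    left
    have h1 := congrFun hc j
    by_cases hj : j = i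
    · subst hj
      simp at h1
      exact ⟨h1.symm, rfl⟩
    · simp [hj] at h1
  | @cons j c x h ih =>
    right
    have h1 := congrFun hc j
    have h2 : 0 ≤ c j := h.nonneg j
    by_cases hj : j = i
    · subst hj
      rcases ih (k - 1) (by rw [sub_smul, ← hc, one_smul, add_sub_cancel_left]) with ⟨-, rfl⟩ | rfl
      · simp
      · simp
    · simp [hj] at h1
      omega

theorem gs_single (i : Fin 10) : gs (Pi.single i 1) = Submodule.span ℂ {genE i} := by
  apply le_antisymm
  · refine gs_le_of_words (by simp) (by simp) fun x hx => ?_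
    rcases isWord_multiple hx i 1 (by simp) with ⟨-, rfl⟩ | rfl
    · exact Submodule.mem_span_singleton_self _
    · exact zero_mem _
  · rw [Submodule.span_singleton_le_iff_mem]
    exact genE_mem_gs i

theorem gs_multiple (i : Fin 10) (k : ℤ) (hk : 2 ≤ k) : gs (k • Pi.single i 1) = ⊥ := by
  refine eq_bot_iff.2 (gs_le_of_words (smul_nonneg (by omega) (by simp))
    (smul_ne_zero (by omega) (by simp)) fun x hx => ?_)
  rcases isWord_multiple hx i k rfl with ⟨h, -⟩ | rfl
  · omega
  · exact zero_mem _

/-- A word that is not a single letter has an outermost letter to strip; this bounds a root space by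
those one simple root lower. -/
theorem gs_le_iSup {c : Fin 10 → ℤ} (hc : 0 ≤ c) (h0 : c ≠ 0) (hs : ∀ i, c ≠ Pi.single i 1) :
    gs c ≤ ⨆ i, (gs (c - Pi.single i 1)).map (LieAlgebra.ad ℂ Alg (genE i)) := by
  refine gs_le_of_words hc h0 fun x hx => ?_
  cases hx with
  | single i => exact (hs i rfl).elim
  | @cons i d x h =>
    refine Submodule.mem_iSup_of_mem i ⟨x, ?_, rfl⟩
    rw [add_sub_cancel_left]
    exact h.mem_gs

end ETen

/-! ### Exponentials of locally nilpotent inner derivations. -/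

namespace ETen

open Finset in
-- The Cauchy product of two terminating series, used both for multiplicativity and for inverses of
-- exponentials.
theorem sum_antidiagonal_eq_sum_range {M : Type*} [AddCommMonoid M] (F : ℕ → ℕ → M) (a b : ℕ)
    (ha : ∀ i j, a ≤ i → F i j = 0) (hb : ∀ i j, b ≤ j → F i j = 0) :
    ∑ n ∈ range (a + b), ∑ p ∈ antidiagonal n, F p.1 p.2 =
      ∑ i ∈ range a, ∑ j ∈ range b, F i j := by
  rw [← sum_product', ← sum_fiberwise_of_maps_to (s := range a ×ˢ range b) (t := range (a + b))
    (g := fun p => p.1 + p.2)]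
  · refine sum_congr rfl fun n _ => (sum_subset ?_ ?_).symm
    · intro p hp
      simp only [mem_filter] at hp
      exact HasAntidiagonal.mem_antidiagonal.2 hp.2
    · intro p hp hp'
      simp only [mem_filter, mem_product, mem_range, not_and] at hp'
      rw [HasAntidiagonal.mem_antidiagonal] at hp
      by_cases h1 : p.1 < a
      · by_cases h2 : p.2 < b
        · exact (hp' ⟨h1, h2⟩ hp).elim
        · exact hb _ _ (by omega)
      · exact ha _ _ (by omega)
  · intro p hp
    simp only [mem_product, mem_range] at hp ⊢
    omega

section exponential

variable {L : Type*} [LieRing L] [LieAlgebra ℂ L]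

open LieAlgebra Finset

/-- The exponential of `ad x`, for `ad x` locally nilpotent. -/
def adExp (x y : L) : L := ∑ᶠ k : ℕ, ((k.factorial : ℂ)⁻¹) • (ad ℂ L x ^ k) y

theorem ad_pow_eq_zero_of_le {x y : L} {m n : ℕ} (h : (ad ℂ L x ^ m) y = 0) (hmn : m ≤ n) :
    (ad ℂ L x ^ n) y = 0 := by
  obtain ⟨k, rfl⟩ := Nat.exists_eq_add_of_le hmn
  rw [add_comm, pow_add, Module.End.mul_apply, h, map_zero]

theorem adExp_eq_sum {x y : L} {n : ℕ} (h : (ad ℂ L x ^ n) y = 0) :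
    adExp x y = ∑ k ∈ range n, ((k.factorial : ℂ)⁻¹) • (ad ℂ L x ^ k) y := by
  refine finsum_eq_sum_of_support_subset _ fun k hk => ?_
  rw [coe_range, Set.mem_Iio]
  by_contra hkn
  exact hk (by simp only [ad_pow_eq_zero_of_le h (not_lt.1 hkn), smul_zero])

/-- The Leibniz formula for (ad x)^n, divided by n!, is the n-th term of a Cauchy product. -/
theorem adExp_lie {x : L} (hx : ∀ y, ∃ n, (ad ℂ L x ^ n) y = 0) (y z : L) :
    adExp x ⁅y, z⁆ = ⁅adExp x y, adExp x z⁆ := by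
  obtain ⟨a, ha⟩ := hx y
  obtain ⟨b, hb⟩ := hx z
  let F : ℕ → ℕ → L := fun i j =>
    ⁅((i.factorial : ℂ)⁻¹) • (ad ℂ L x ^ i) y, ((j.factorial : ℂ)⁻¹) • (ad ℂ L x ^ j) z⁆
  have hFa : ∀ i j, a ≤ i → F i j = 0 := fun i j h => by
    simp only [F, ad_pow_eq_zero_of_le ha h, smul_zero, zero_lie]
  have hFb : ∀ i j, b ≤ j → F i j = 0 := fun i j h => by
    simp only [F, ad_pow_eq_zero_of_le hb h, smul_zero, lie_zero]
  have hF : ∀ n, ∑ p ∈ antidiagonal n, F p.1 p.2 =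
      ((n.factorial : ℂ)⁻¹) • (ad ℂ L x ^ n) ⁅y, z⁆ := by
    intro n
    rw [LieAlgebra.ad_pow_lie, smul_sum]
    refine sum_congr rfl fun p hp => ?_
    rw [HasAntidiagonal.mem_antidiagonal] at hp
    subst hp
    simp only [F, smul_lie, lie_smul, smul_smul]
    rw [← Nat.cast_smul_eq_nsmul ℂ, smul_smul, Nat.cast_add_choose]
    congr 1
    have h1 : ((p.1 + p.2).factorial : ℂ) ≠ 0 := by exact_mod_cast Nat.factorial_ne_zero _
    field_simp
  have h0 : (ad ℂ L x ^ (a + b)) ⁅y, z⁆ = 0 := by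
    rw [LieAlgebra.ad_pow_lie]
    refine sum_eq_zero fun p hp => ?_
    rw [HasAntidiagonal.mem_antidiagonal] at hp
    rcases le_or_gt a p.1 with h | h
    · rw [ad_pow_eq_zero_of_le ha h, zero_lie, smul_zero]
    · rw [ad_pow_eq_zero_of_le hb (show b ≤ p.2 by omega), lie_zero, smul_zero]
  rw [adExp_eq_sum h0, ← sum_congr rfl fun n _ => hF n, sum_antidiagonal_eq_sum_range F a b hFa hFb,
    adExp_eq_sum ha, adExp_eq_sum hb, sum_lie_sum]

/-- The terms of total degree n sum to (1 - 1)^n / n! times (ad x)^n y, so only n = 0 survives. -/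
theorem adExp_adExp_neg {x : L} (hx : ∀ y, ∃ n, (ad ℂ L x ^ n) y = 0) (y : L) :
    adExp x (adExp (-x) y) = y := by
  obtain ⟨a, ha⟩ := hx y
  have hneg : ∀ k, (ad ℂ L (-x) ^ k) y = ((-1 : ℂ) ^ k) • (ad ℂ L x ^ k) y := by
    intro k
    rw [map_neg, ← neg_one_smul ℂ (ad ℂ L x), smul_pow, LinearMap.smul_apply]
  have ha' : (ad ℂ L (-x) ^ a) y = 0 := by rw [hneg, ha, smul_zero]
  have hz : (ad ℂ L x ^ a) (adExp (-x) y) = 0 := by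
    rw [adExp_eq_sum ha', map_sum]
    refine sum_eq_zero fun k _ => ?_
    rw [hneg, map_smul, map_smul, ← Module.End.mul_apply, ← pow_add,
      ad_pow_eq_zero_of_le ha (Nat.le_add_right _ _), smul_zero, smul_zero]
  let F : ℕ → ℕ → L := fun i j =>
    ((i.factorial : ℂ)⁻¹ * ((j.factorial : ℂ)⁻¹ * (-1) ^ j)) • (ad ℂ L x ^ (i + j)) y
  have hF : ∀ n, ∑ p ∈ antidiagonal n, F p.1 p.2 = if n = 0 then y else 0 := by
    intro n
    have h1 : ∀ p ∈ antidiagonal n, F p.1 p.2 = (((n.factorial : ℂ)⁻¹) *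
        ((n.choose p.1) • ((1 : ℂ) ^ p.1 * (-1) ^ p.2))) • (ad ℂ L x ^ n) y := by
      intro p hp
      rw [HasAntidiagonal.mem_antidiagonal] at hp
      subst hp
      simp only [F]
      congr 1
      rw [nsmul_eq_mul, Nat.cast_add_choose]
      have h1 : ((p.1 + p.2).factorial : ℂ) ≠ 0 := by exact_mod_cast Nat.factorial_ne_zero _
      field_simp
      simp
    rw [sum_congr rfl h1, ← sum_smul, ← mul_sum, ← (Commute.all (1 : ℂ) (-1)).add_pow',
      add_neg_cancel]
    split_ifs with h
    · subst h; simp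
    · simp [h]
  rw [adExp_eq_sum hz]
  have h2 : ∀ i ∈ range a, ((i.factorial : ℂ)⁻¹) • (ad ℂ L x ^ i) (adExp (-x) y) =
      ∑ j ∈ range a, F i j := by
    intro i _
    rw [adExp_eq_sum ha', map_sum, smul_sum]
    refine sum_congr rfl fun j _ => ?_
    rw [hneg, map_smul, map_smul, ← Module.End.mul_apply, ← pow_add, smul_smul, smul_smul,
      mul_assoc]
  rw [sum_congr rfl h2, ← sum_antidiagonal_eq_sum_range F a a, sum_congr rfl fun n _ => hF n]
  -- If a = 0, then `ha` says y = 0 and the sum is empty.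
  · rcases Nat.eq_zero_or_pos a with h | h
    · subst h
      simpa using ha.symm
    · rw [sum_ite_eq' (range (a + a)) 0 (fun _ => y), if_pos (mem_range.2 (by omega))]
  · intro i j h
    simp only [F, ad_pow_eq_zero_of_le ha (h.trans (Nat.le_add_right i j)), smul_zero]
  · intro i j h
    simp only [F, ad_pow_eq_zero_of_le ha (h.trans (Nat.le_add_left j i)), smul_zero]

theorem ad_neg_locallyNilpotent {x : L} (hx : ∀ y, ∃ n, (ad ℂ L x ^ n) y = 0) (y : L) :
    ∃ n, (ad ℂ L (-x) ^ n) y = 0 := by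
  obtain ⟨n, hn⟩ := hx y
  refine ⟨n, ?_⟩
  rw [map_neg, ← neg_one_smul ℂ (ad ℂ L x), smul_pow, LinearMap.smul_apply, hn, smul_zero]

/-- The exponential of a locally nilpotent `ad x`, as an automorphism. -/
def adExpEquiv (x : L) (hx : ∀ y, ∃ n, (ad ℂ L x ^ n) y = 0) : L ≃ₗ⁅ℂ⁆ L where
  toFun := adExp x
  invFun := adExp (-x)
  map_add' y z := by
    obtain ⟨a, ha⟩ := hx y
    obtain ⟨b, hb⟩ := hx z
    have ha' := ad_pow_eq_zero_of_le ha (le_max_left a b)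
    have hb' := ad_pow_eq_zero_of_le hb (le_max_right a b)
    rw [adExp_eq_sum ha', adExp_eq_sum hb',
      adExp_eq_sum (n := max a b) (by rw [map_add, ha', hb', add_zero]),
      ← sum_add_distrib]
    simp only [map_add, smul_add]
  map_smul' c y := by
    obtain ⟨a, ha⟩ := hx y
    rw [adExp_eq_sum ha, adExp_eq_sum (n := a) (by rw [map_smul, ha, smul_zero]), smul_sum]
    simp only [map_smul, RingHom.id_apply, smul_comm c]
  map_lie' := adExp_lie hx _ _
  left_inv y := by simpa using adExp_adExp_neg (ad_neg_locallyNilpotent hx) y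
  right_inv := adExp_adExp_neg hx

theorem adExpEquiv_apply (x : L) (hx : ∀ y, ∃ n, (ad ℂ L x ^ n) y = 0) (y : L) :
    adExpEquiv x hx y = adExp x y := rfl

theorem adExp_of_lie_eq_zero {x y : L} (h : ⁅x, y⁆ = 0) : adExp x y = y := by
  rw [adExp_eq_sum (n := 1) (by simpa using h)]
  simp

theorem adExp_of_lie_lie_eq_zero {x y : L} (h : ⁅x, ⁅x, y⁆⁆ = 0) : adExp x y = y + ⁅x, y⁆ := by
  rw [adExp_eq_sum (n := 2) (by simpa [pow_succ'] using h)]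
  simp [sum_range_succ]

theorem adExp_of_lie_lie_lie_eq_zero {x y : L} (h : ⁅x, ⁅x, ⁅x, y⁆⁆⁆ = 0) :
    adExp x y = y + ⁅x, y⁆ + (2⁻¹ : ℂ) • ⁅x, ⁅x, y⁆⁆ := by
  rw [adExp_eq_sum (n := 3) (by simpa [pow_succ'] using h)]
  simp [sum_range_succ, pow_succ', Nat.factorial]

end exponential

end ETen

/-! ### Lifting the Weyl group to automorphisms. -/

namespace ETen

open LieAlgebra

theorem lie_genE_genF_self (i : Fin 10) : ⁅genE i, genF i⁆ = genH i := by
  rw [lie_genE_genF, if_pos rfl]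

theorem lie_genF_genE_self (i : Fin 10) : ⁅genF i, genE i⁆ = -genH i := by
  rw [← lie_skew, lie_genE_genF_self]

theorem lie_genE_genH (i j : Fin 10) : ⁅genE i, genH j⁆ = -(cartanMatrix j i : ℂ) • genE i := by
  rw [← lie_skew, lie_genH_genE, neg_smul]

theorem lie_genF_genH (i j : Fin 10) : ⁅genF i, genH j⁆ = (cartanMatrix j i : ℂ) • genF i := by
  rw [← lie_skew, lie_genH_genF, neg_smul, neg_neg]

/-- The elements killed by a power of ad e_i form the Engel subalgebra, so generators suffice; for
e_j this is the Serre relation. -/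
theorem ad_genE_locallyNilpotent (i : Fin 10) (y : Alg) :
    ∃ n, (ad ℂ Alg (genE i) ^ n) y = 0 := by
  rw [← LieSubalgebra.mem_engel_iff]
  refine mem_of_generators _ (fun j => ?_) (fun j => ?_) (fun j => ?_) y <;>
    rw [LieSubalgebra.mem_engel_iff]
  · refine ⟨2, ?_⟩
    rw [pow_two, Module.End.mul_apply, ad_apply, ad_apply, lie_genE_genH]
    simp
  · refine ⟨(-cartanMatrix i j).toNat + 1, ?_⟩
    rw [pow_succ, Module.End.mul_apply, ad_apply, serre_genE]
  · refine ⟨3, ?_⟩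
    rw [pow_succ, pow_two, Module.End.mul_apply, Module.End.mul_apply, ad_apply, ad_apply, ad_apply,
      lie_genE_genF]
    split_ifs
    · rw [lie_genE_genH]; simp
    · simp

theorem ad_genF_locallyNilpotent (i : Fin 10) (y : Alg) :
    ∃ n, (ad ℂ Alg (genF i) ^ n) y = 0 := by
  rw [← LieSubalgebra.mem_engel_iff]
  refine mem_of_generators _ (fun j => ?_) (fun j => ?_) (fun j => ?_) y <;>
    rw [LieSubalgebra.mem_engel_iff]
  · refine ⟨2, ?_⟩
    rw [pow_two, Module.End.mul_apply, ad_apply, ad_apply, lie_genF_genH]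
    simp
  · refine ⟨3, ?_⟩
    rw [pow_succ, pow_two, Module.End.mul_apply, Module.End.mul_apply, ad_apply, ad_apply, ad_apply,
      ← lie_skew (genF i) (genE j), lie_genE_genF]
    split_ifs
    · rw [lie_neg, lie_genF_genH]; simp
    · simp
  · refine ⟨(-cartanMatrix i j).toNat + 1, ?_⟩
    rw [pow_succ, Module.End.mul_apply, ad_apply, serre_genF]

/-- The automorphism `exp (ad e_i)`. -/
def expE (i : Fin 10) : Alg ≃ₗ⁅ℂ⁆ Alg := adExpEquiv (genE i) (ad_genE_locallyNilpotent i)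

/-- The automorphism `exp (-ad f_i)`. -/
def expF (i : Fin 10) : Alg ≃ₗ⁅ℂ⁆ Alg :=
  adExpEquiv (-genF i) (ad_neg_locallyNilpotent (ad_genF_locallyNilpotent i))

/-- The automorphism of `E₁₀` that lifts the `i`-th simple reflection. -/
def weylAut (i : Fin 10) : Alg ≃ₗ⁅ℂ⁆ Alg := ((expE i).trans (expF i)).trans (expE i)

theorem weylAut_apply (i : Fin 10) (x : Alg) : weylAut i x = expE i (expF i (expE i x)) := rfl

theorem expE_genE (i : Fin 10) : expE i (genE i) = genE i := adExp_of_lie_eq_zero (lie_self _)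

theorem expE_genH (i j : Fin 10) :
    expE i (genH j) = genH j - (cartanMatrix j i : ℂ) • genE i := by
  rw [expE, adExpEquiv_apply, adExp_of_lie_lie_eq_zero] <;> rw [lie_genE_genH]
  · rw [neg_smul, sub_eq_add_neg]
  · simp

theorem expF_genH (i j : Fin 10) :
    expF i (genH j) = genH j - (cartanMatrix j i : ℂ) • genF i := by
  rw [expF, adExpEquiv_apply, adExp_of_lie_lie_eq_zero] <;>
    rw [neg_lie (genF i) (genH j), lie_genF_genH]
  · rw [sub_eq_add_neg]
  · simp

theorem expF_genE (i : Fin 10) : expF i (genE i) = genE i + genH i - genF i := by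
  have h : ⁅-genF i, genE i⁆ = genH i := by rw [neg_lie, lie_genF_genE_self, neg_neg]
  have h2 : ⁅-genF i, genH i⁆ = -(2 : ℂ) • genF i := by
    rw [neg_lie, lie_genF_genH, cartanMatrix_self]; simp
  rw [expF, adExpEquiv_apply, adExp_of_lie_lie_lie_eq_zero] <;> rw [h, h2]
  · module
  · simp

theorem weylAut_genH (i j : Fin 10) :
    weylAut i (genH j) = genH j - (cartanMatrix j i : ℂ) • genH i := by
  have h : genH j - (cartanMatrix j i : ℂ) • genF i -
      (cartanMatrix j i : ℂ) • (genE i + genH i - genF i) =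
      genH j - (cartanMatrix j i : ℂ) • genE i - (cartanMatrix j i : ℂ) • genH i := by module
  rw [weylAut_apply, expE_genH, map_sub, map_smul, expF_genH, expF_genE, h, map_sub, map_sub,
    map_smul, map_smul, expE_genH, expE_genH, expE_genE, cartanMatrix_self]
  push_cast
  module

/-- By `weylAut_genH` the automorphism acts on the h_j as the i-th reflection of the coroots, so it
moves weights by the dual reflection. -/
theorem weylAut_mem_rootSpace_iff (i : Fin 10) (α : Module.Dual ℝ Cartan) (x : Alg) :
    weylAut i x ∈ rootSpace (simpleReflection i α) ↔ x ∈ rootSpace α := by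
  have hr : ∀ j, simpleReflection i α (coroot j) =
      α (coroot j) - α (coroot i) * cartanMatrix j i := fun j => by
    rw [simpleReflection_apply, LinearMap.sub_apply, LinearMap.smul_apply, simpleRoot_coroot,
      smul_eq_mul]
  constructor
  · intro h
    rw [mem_rootSpace] at h ⊢
    intro j
    apply (EquivLike.injective (weylAut i))
    rw [LieEquiv.map_lie, weylAut_genH, sub_lie, smul_lie, h, h, hr, hr, map_smul,
      cartanMatrix_self, smul_smul, ← sub_smul]
    congr 1
    push_cast
    ring
  · intro h
    rw [mem_rootSpace] at h ⊢
    intro j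
    have hj : genH j = weylAut i (genH j - (cartanMatrix j i : ℂ) • genH i) := by
      rw [map_sub, map_smul, weylAut_genH, weylAut_genH, cartanMatrix_self]
      push_cast
      module
    rw [hr, hj, ← LieEquiv.map_lie, sub_lie, smul_lie, h, h, map_sub, map_smul, map_smul, map_smul,
      smul_smul, ← sub_smul]
    congr 1
    push_cast
    ring

/-- Every element of the Weyl group lifts to an automorphism of `E₁₀`. -/
theorem exists_lift {w : Module.Dual ℝ Cartan ≃ₗ[ℝ] Module.Dual ℝ Cartan} (hw : w ∈ weylGroup) :
    ∃ T : Alg ≃ₗ⁅ℂ⁆ Alg, ∀ α x, T x ∈ rootSpace (w α) ↔ x ∈ rootSpace α := by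
  induction hw using Subgroup.closure_induction with
  | mem _ h =>
    obtain ⟨i, rfl⟩ := h
    exact ⟨weylAut i, weylAut_mem_rootSpace_iff i⟩
  | one => exact ⟨LieEquiv.refl, fun _ _ => Iff.rfl⟩
  | mul a b _ _ ha hb =>
    obtain ⟨S, hS⟩ := ha
    obtain ⟨T, hT⟩ := hb
    exact ⟨T.trans S, fun α x => (hS (b α) (T x)).trans (hT α x)⟩
  | inv a _ ha =>
    obtain ⟨S, hS⟩ := ha
    refine ⟨S.symm, fun α x => ?_⟩
    have := hS (a⁻¹ α) (S.symm x)
    rw [LieEquiv.apply_symm_apply] at this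
    rw [← this]
    change x ∈ rootSpace (a (a.symm α)) ↔ _
    rw [LinearEquiv.apply_symm_apply]

theorem exists_neg_lift : ∃ ω : Alg ≃ₗ⁅ℂ⁆ Alg, ∀ α x, ω x ∈ rootSpace (-α) ↔ x ∈ rootSpace α := by
  obtain ⟨ω, hω, -, -⟩ := exists_chevalley
  refine ⟨ω, fun α x => ?_⟩
  rw [mem_rootSpace, mem_rootSpace]
  refine forall_congr' fun i => ?_
  rw [← (EquivLike.injective ω).eq_iff (a := ⁅genH i, x⁆), LieEquiv.map_lie, hω, neg_lie, map_smul,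
    LinearMap.neg_apply, Complex.ofReal_neg, neg_smul]
  exact ⟨fun h => by rw [h, neg_neg], fun h => by rw [← h, neg_neg]⟩

/-- Root spaces that correspond under an automorphism are isomorphic. -/
def rootSpaceEquiv (T : Alg ≃ₗ⁅ℂ⁆ Alg) {α β : Module.Dual ℝ Cartan}
    (h : ∀ x, T x ∈ rootSpace β ↔ x ∈ rootSpace α) : rootSpace α ≃ₗ[ℂ] rootSpace β where
  toFun x := ⟨T x, (h x).2 x.2⟩
  map_add' x y := Subtype.ext (map_add T (x : Alg) y)
  map_smul' c x := Subtype.ext (map_smul T c (x : Alg))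
  invFun y := ⟨T.symm y, (h _).1 (by rw [LieEquiv.apply_symm_apply]; exact y.2)⟩
  left_inv x := Subtype.ext (T.symm_apply_apply x)
  right_inv y := Subtype.ext (T.apply_symm_apply y)

theorem multiplicity_weyl {w : Module.Dual ℝ Cartan ≃ₗ[ℝ] Module.Dual ℝ Cartan}
    (hw : w ∈ weylGroup) (α : Module.Dual ℝ Cartan) : multiplicity (w α) = multiplicity α := by
  obtain ⟨T, hT⟩ := exists_lift hw
  exact (rootSpaceEquiv T (hT α)).symm.rank_eq

theorem multiplicity_neg (α : Module.Dual ℝ Cartan) : multiplicity (-α) = multiplicity α := by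
  obtain ⟨T, hT⟩ := exists_neg_lift
  exact (rootSpaceEquiv T (hT α)).symm.rank_eq

theorem rootSpace_eq_bot_iff (α : Module.Dual ℝ Cartan) : rootSpace α = ⊥ ↔ multiplicity α = 0 :=
  Submodule.rank_eq_zero.symm

/-! ### The root lattice: norms, reflections, conjugacy of roots. -/

/-- The norm `(c | c)` of an element of the root lattice. -/
def qnorm (c : Fin 10 → ℤ) : ℤ := ∑ i, c i * pairing c i

theorem sum_mul_pairing_comm (c d : Fin 10 → ℤ) :
    ∑ i, c i * pairing d i = ∑ i, d i * pairing c i := by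
  simp only [pairing, Finset.mul_sum]
  rw [Finset.sum_comm]
  refine Finset.sum_congr rfl fun i _ => Finset.sum_congr rfl fun j _ => ?_
  rw [cartanMatrix_comm j i]
  ring

theorem qnorm_add (c d : Fin 10 → ℤ) :
    qnorm (c + d) = qnorm c + qnorm d + 2 * ∑ i, c i * pairing d i := by
  have h : qnorm (c + d) = qnorm c + qnorm d +
      (∑ i, c i * pairing d i + ∑ i, d i * pairing c i) := by
    simp only [qnorm, pairing_add, Pi.add_apply, ← Finset.sum_add_distrib]
    exact Finset.sum_congr rfl fun i _ => by ring
  rw [h, sum_mul_pairing_comm d c]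
  ring

theorem qnorm_neg (c : Fin 10 → ℤ) : qnorm (-c) = qnorm c := by
  simp [qnorm, pairing_neg]

theorem qnorm_add_single (c : Fin 10 → ℤ) (i : Fin 10) (k : ℤ) :
    qnorm (c + k • Pi.single i 1) = qnorm c + 2 * k * pairing c i + 2 * k ^ 2 := by
  have h1 : ∀ p : Fin 10 → ℤ, ∑ j, (k • Pi.single i 1 : Fin 10 → ℤ) j * p j = k * p i := fun p => by
    simp [Pi.single_apply]
  rw [qnorm_add, sum_mul_pairing_comm, h1, qnorm, qnorm, h1, pairing_zsmul, pairing_single,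
    cartanMatrix_self]
  ring

theorem form_root (c d : Fin 10 → ℤ) : form (root c) (root d) = ∑ i, c i * pairing d i := by
  simp only [root_apply, map_sum, map_smul, LinearMap.sum_apply, LinearMap.smul_apply,
    form_simpleRoot, pairing, smul_eq_mul]
  push_cast
  simp only [Finset.mul_sum]
  rw [Finset.sum_comm]
  exact Finset.sum_congr rfl fun i _ => Finset.sum_congr rfl fun j _ => by ring

theorem form_root_self (c : Fin 10 → ℤ) : form (root c) (root c) = qnorm c := by
  rw [form_root, qnorm]

/-- The simple reflections in coordinates. -/
def refl (i : Fin 10) (c : Fin 10 → ℤ) : Fin 10 → ℤ := c - pairing c i • Pi.single i 1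

theorem root_refl (i : Fin 10) (c : Fin 10 → ℤ) :
    root (refl i c) = simpleReflection i (root c) := by
  rw [refl, map_sub, map_zsmul, root_single, simpleReflection_apply, root_coroot,
    ← Int.cast_smul_eq_zsmul ℝ]

theorem qnorm_refl (i : Fin 10) (c : Fin 10 → ℤ) : qnorm (refl i c) = qnorm c := by
  rw [refl, sub_eq_add_neg, ← neg_smul, qnorm_add_single]; ring

theorem refl_apply_of_ne {i j : Fin 10} (h : j ≠ i) (c : Fin 10 → ℤ) : refl i c j = c j := by
  simp [refl, h]

theorem sum_refl (i : Fin 10) (c : Fin 10 → ℤ) : ∑ j, refl i c j = ∑ j, c j - pairing c i := by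
  simp [refl, Finset.sum_sub_distrib, Pi.single_apply]

theorem simpleReflection_mem (i : Fin 10) : simpleReflection i ∈ weylGroup :=
  Subgroup.subset_closure ⟨i, rfl⟩

/-- The coordinates of `δ`. -/
def deltaVec : Fin 10 → ℤ := ![0, 1, 2, 3, 4, 5, 6, 4, 2, 3]

theorem root_deltaVec : root deltaVec = delta := by
  have h : deltaVec = Pi.single 1 1 + (2 : ℤ) • Pi.single 2 1 + (3 : ℤ) • Pi.single 3 1 +
      (4 : ℤ) • Pi.single 4 1 + (5 : ℤ) • Pi.single 5 1 + (6 : ℤ) • Pi.single 6 1 +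
      (4 : ℤ) • Pi.single 7 1 + (2 : ℤ) • Pi.single 8 1 + (3 : ℤ) • Pi.single 9 1 := by decide
  simp only [h, map_add, map_zsmul, root_single, delta]

theorem inverse_pairing (c : Fin 10 → ℤ) (i : Fin 10) :
    ∑ k, cartanMatrixInv i k * pairing c k = c i := by
  simp only [pairing, Finset.mul_sum]
  rw [Finset.sum_comm]
  simp only [← mul_assoc, ← Finset.sum_mul, cartanMatrixInv_mul]
  simp

/-- The isotropic elements of the antidominant cone are multiples of `δ`. -/
theorem eq_smul_delta {c : Fin 10 → ℤ} (hc : 0 ≤ c) (hp : ∀ i, pairing c i ≤ 0)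
    (hn : qnorm c = 0) : c = (-pairing c 0) • deltaVec := by
  have h0 : ∀ i, c i * pairing c i = 0 := fun i =>
    (Finset.sum_eq_zero_iff_of_nonpos (fun i _ =>
      mul_nonpos_of_nonneg_of_nonpos (hc i) (hp i))).1 hn i (Finset.mem_univ i)
  -- The inverse Cartan matrix has no positive entry, its only zero on the diagonal is at index 0,
  -- and its column 0 is -δ (`hcol`).
  have hinv : ∀ i k, 0 ≤ -cartanMatrixInv i k := by decide
  have hdiag : ∀ i, i ≠ 0 → 0 < -cartanMatrixInv i i := by decide
  -- If the pairing at i ≠ 0 were nonzero, then c i = 0 by `h0`; but c i is a sum of nonnegative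
  -- terms (A⁻¹)_ik · `pairing c k` whose i-th term would be positive.
  have hz : ∀ i, i ≠ 0 → pairing c i = 0 := by
    intro i hi
    by_contra hpi
    have h1 : c i = 0 := (mul_eq_zero.1 (h0 i)).resolve_right hpi
    have h2 := inverse_pairing c i
    rw [h1] at h2
    have h3 := (Finset.sum_eq_zero_iff_of_nonneg (fun k _ => by
      have := mul_nonneg (hinv i k) (neg_nonneg.2 (hp k))
      rwa [neg_mul_neg] at this)).1 h2 i (Finset.mem_univ i)
    rcases mul_eq_zero.1 h3 with h | h
    · have := hdiag i hi
      omega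
    · exact hpi h
  have hcol : ∀ i, cartanMatrixInv i 0 + deltaVec i = 0 := by decide
  ext i
  have h2 := inverse_pairing c i
  rw [Finset.sum_eq_single 0 (fun k _ hk => by rw [hz k hk, mul_zero]) (by simp)] at h2
  rw [← h2, Pi.smul_apply, smul_eq_mul]
  linear_combination pairing c 0 * hcol i

theorem gs_ne_bot_refl {c : Fin 10 → ℤ} (i : Fin 10) (h : gs c ≠ ⊥) : gs (refl i c) ≠ ⊥ := by
  rw [Ne, rootSpace_eq_bot_iff] at h ⊢
  rwa [root_refl, multiplicity_weyl (simpleReflection_mem i)]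

theorem gs_neg_ne_bot {c : Fin 10 → ℤ} (h : gs c ≠ ⊥) : gs (-c) ≠ ⊥ := by
  rw [Ne, rootSpace_eq_bot_iff] at h ⊢
  rwa [map_neg, multiplicity_neg]

/-- The roots in the root lattice are positive or negative. -/
theorem nonneg_or_nonpos {c : Fin 10 → ℤ} (h : gs c ≠ ⊥) : 0 ≤ c ∨ 0 ≤ -c := by
  by_cases h0 : c = 0
  · exact .inl h0.ge
  · obtain ⟨d, hd, -, h1 | h1⟩ := root_cases h
      (fun h2 => h0 (root_injective (h2.trans (map_zero root).symm)))
    · rw [root_injective h1]; exact .inl hd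
    · rw [root_injective h1, neg_neg]; exact .inr hd

/-- A positive root of nonnegative norm is conjugate to a simple root or to a multiple of `δ`. -/
theorem exists_weyl_of_pos {c : Fin 10 → ℤ} (hc : 0 ≤ c) (h0 : c ≠ 0) (h : gs c ≠ ⊥)
    (hn : 0 ≤ qnorm c) : ∃ w ∈ weylGroup, (qnorm c = 2 ∧ ∃ i, w (root c) = root (Pi.single i 1)) ∨
      (qnorm c = 0 ∧ ∃ n : ℤ, 0 < n ∧ w (root c) = root (n • deltaVec)) := by
  -- Induction on the height, which a reflection with positive pairing lowers.
  obtain ⟨N, hN⟩ : ∃ N : ℕ, ∑ i, c i ≤ N := ⟨_, Int.self_le_toNat _⟩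
  induction N generalizing c with
  | zero =>
    have h1 : ∑ i, c i = 0 := le_antisymm hN (Finset.sum_nonneg fun i _ => hc i)
    exact (h0 (funext fun i => (Finset.sum_eq_zero_iff_of_nonneg fun i _ => hc i).1 h1 i
      (Finset.mem_univ i))).elim
  | succ N ih =>
    by_cases hp : ∀ i, pairing c i ≤ 0
    · have hn0 : qnorm c = 0 := le_antisymm (Finset.sum_nonpos fun i _ =>
        mul_nonpos_of_nonneg_of_nonpos (hc i) (hp i)) hn
      have h1 := eq_smul_delta hc hp hn0
      refine ⟨1, one_mem _, .inr ⟨hn0, -pairing c 0, ?_, by rw [← h1]; rfl⟩⟩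
      refine lt_of_le_of_ne (neg_nonneg.2 (hp 0)) fun h2 => h0 ?_
      rw [h1, ← h2, zero_smul]
    · push Not at hp
      obtain ⟨i, hi⟩ := hp
      -- A second coordinate in the support is unchanged by r_i and keeps the reflected root
      -- positive; without one, c is a multiple of α_i, hence α_i itself.
      by_cases hj : ∃ j, j ≠ i ∧ c j ≠ 0
      · obtain ⟨j, hji, hj⟩ := hj
        have hd := gs_ne_bot_refl i h
        have hjpos : 0 < refl i c j := by
          rw [refl_apply_of_ne hji]; exact lt_of_le_of_ne (hc j) hj.symm
        have hd0 : 0 ≤ refl i c := (nonneg_or_nonpos hd).resolve_right fun h2 => by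
          have h3 : 0 ≤ -refl i c j := h2 j
          omega
        obtain ⟨w, hw, hw'⟩ := ih hd0 (fun h2 => by rw [h2] at hjpos; exact lt_irrefl _ hjpos) hd
          (by rwa [qnorm_refl]) (by rw [sum_refl]; push_cast at hN; omega)
        rw [qnorm_refl, root_refl] at hw'
        exact ⟨w * simpleReflection i, mul_mem hw (simpleReflection_mem i), hw'⟩
      · push Not at hj
        have hci : c = c i • Pi.single i 1 := by
          ext j
          by_cases h1 : j = i
          · subst h1; simp
          · simp [h1, hj j h1]
        have hpos : 0 < c i := lt_of_le_of_ne (hc i) fun h1 => h0 (by rw [hci, ← h1, zero_smul])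
        have hone : c i = 1 := by
          by_contra h1
          exact h (by rw [hci]; exact gs_multiple i (c i) (by omega))
        rw [hone, one_smul] at hci
        refine ⟨1, one_mem _, .inl ⟨?_, i, by rw [hci]; rfl⟩⟩
        rw [hci]
        simp [qnorm, pairing_single, Pi.single_apply, cartanMatrix_self]

/-- A root of larger norm would be conjugate to a simple root or to a multiple of δ, of norm 2 or 0.
The vanishing brackets below all rest on this bound. -/
theorem qnorm_le_two {c : Fin 10 → ℤ} (h : gs c ≠ ⊥) : qnorm c ≤ 2 := by
  by_cases h0 : c = 0
  · subst h0; simp [qnorm]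
  · by_contra hn
    rcases nonneg_or_nonpos h with hc | hc
    · obtain ⟨w, -, ⟨h1, -⟩ | ⟨h1, -⟩⟩ := exists_weyl_of_pos hc h0 h (by omega) <;> omega
    · rw [← qnorm_neg] at hn
      obtain ⟨w, -, ⟨h1, -⟩ | ⟨h1, -⟩⟩ := exists_weyl_of_pos hc (neg_ne_zero.2 h0)
        (gs_neg_ne_bot h) (by omega) <;> omega

theorem gs_eq_bot {c : Fin 10 → ℤ} (h : 2 < qnorm c) : gs c = ⊥ := by
  by_contra h1
  exact absurd (qnorm_le_two h1) (not_le.2 h)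

/-- Root spaces of real roots are lines. -/
theorem multiplicity_eq_one {c : Fin 10 → ℤ} (h : gs c ≠ ⊥) (hn : qnorm c = 2) :
    multiplicity (root c) = 1 := by
  have h0 : c ≠ 0 := by rintro rfl; simp [qnorm] at hn
  have hs : ∀ i, multiplicity (root (Pi.single i 1)) = 1 := fun i => by
    have h1 : gs (Pi.single i 1) = Submodule.span ℂ {genE i} := gs_single i
    change Module.rank ℂ (gs (Pi.single i 1)) = 1
    rw [h1]
    exact Module.rank_eq_one_iff_finrank_eq_one.2 (finrank_span_singleton (genE_ne_zero i))
  have hpos : ∀ {c : Fin 10 → ℤ}, gs c ≠ ⊥ → qnorm c = 2 → c ≠ 0 → 0 ≤ c →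
      multiplicity (root c) = 1 := by
    intro c h hn h0 hc
    obtain ⟨w, hw, ⟨-, i, h1⟩ | ⟨h1, -⟩⟩ := exists_weyl_of_pos hc h0 h (by omega)
    · rw [← multiplicity_weyl hw, h1, hs]
    · omega
  rcases nonneg_or_nonpos h with hc | hc
  · exact hpos h hn h0 hc
  · rw [← multiplicity_neg, ← map_neg]
    exact hpos (gs_neg_ne_bot h) (by rwa [qnorm_neg]) (neg_ne_zero.2 h0) hc

theorem gs_le_span_singleton {c : Fin 10 → ℤ} (hn : qnorm c = 2) {x : Alg} (hx : x ∈ gs c)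
    (h0 : x ≠ 0) : gs c ≤ Submodule.span ℂ {x} := by
  have h : gs c ≠ ⊥ := fun h => h0 (by rw [h] at hx; exact hx)
  have h1 := multiplicity_eq_one h hn
  intro y hy
  obtain ⟨a, ha⟩ := (finrank_eq_one_iff_of_nonzero' (⟨x, hx⟩ : gs c) (by simpa using h0)).1
    (Module.rank_eq_one_iff_finrank_eq_one.1 h1) ⟨y, hy⟩
  exact Submodule.mem_span_singleton.2 ⟨a, congrArg Subtype.val ha⟩

/-! ### Words in the reflections and the affine Weyl group. -/

/-- The action of a word in the simple reflections, in coordinates. -/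
def reflWord : List (Fin 10) → (Fin 10 → ℤ) → Fin 10 → ℤ
  | [], c => c
  | i :: l, c => reflWord l (refl i c)

/-- The automorphism of `E₁₀` that lifts a word in the simple reflections. -/
def weylAutWord : List (Fin 10) → Alg ≃ₗ⁅ℂ⁆ Alg
  | [] => LieEquiv.refl
  | i :: l => (weylAut i).trans (weylAutWord l)

theorem weylAutWord_cons (i : Fin 10) (l : List (Fin 10)) (x : Alg) :
    weylAutWord (i :: l) x = weylAutWord l (weylAut i x) := rfl

theorem weylAutWord_mem (l : List (Fin 10)) {c : Fin 10 → ℤ} {x : Alg} (hx : x ∈ gs c) :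
    weylAutWord l x ∈ gs (reflWord l c) := by
  induction l generalizing c x with
  | nil => exact hx
  | cons i l ih =>
    rw [weylAutWord_cons]
    refine ih ?_
    rw [gs, root_refl]
    exact (weylAut_mem_rootSpace_iff i _ x).2 hx

theorem reflWord_append (l m : List (Fin 10)) (c : Fin 10 → ℤ) :
    reflWord (l ++ m) c = reflWord m (reflWord l c) := by
  induction l generalizing c with
  | nil => rfl
  | cons i l ih => exact ih _

theorem refl_add (i : Fin 10) (c d : Fin 10 → ℤ) : refl i (c + d) = refl i c + refl i d := by
  simp only [refl, pairing_add, add_smul]; abel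

theorem refl_neg (i : Fin 10) (c : Fin 10 → ℤ) : refl i (-c) = -refl i c := by
  simp only [refl, pairing_neg, neg_smul]; abel

theorem reflWord_add (l : List (Fin 10)) (c d : Fin 10 → ℤ) :
    reflWord l (c + d) = reflWord l c + reflWord l d := by
  induction l generalizing c d with
  | nil => rfl
  | cons i l ih => rw [reflWord, refl_add, ih]; rfl

theorem reflWord_neg (l : List (Fin 10)) (c : Fin 10 → ℤ) :
    reflWord l (-c) = -reflWord l c := by
  induction l generalizing c with
  | nil => rfl
  | cons i l ih => rw [reflWord, refl_neg, ih]; rfl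

theorem reflWord_sub (l : List (Fin 10)) (c d : Fin 10 → ℤ) :
    reflWord l (c - d) = reflWord l c - reflWord l d := by
  rw [sub_eq_add_neg, reflWord_add, reflWord_neg, sub_eq_add_neg]

theorem pairing_deltaVec {i : Fin 10} (hi : i ≠ 0) : pairing deltaVec i = 0 := by
  revert i; decide

theorem reflWord_smul_delta {l : List (Fin 10)} (hl : ∀ i ∈ l, i ≠ 0) (n : ℤ) :
    reflWord l (n • deltaVec) = n • deltaVec := by
  induction l with
  | nil => rfl
  | cons i l ih =>
    rw [List.forall_mem_cons] at hl
    rw [reflWord, refl, pairing_zsmul, pairing_deltaVec hl.1, mul_zero, zero_smul, sub_zero,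
      ih hl.2]

/-- An affine Weyl group element exchanges `α` and `δ - α` for a simple root `α`. -/
theorem exists_word_delta_sub : ∃ l : List (Fin 10), (∀ i ∈ l, i ≠ 0) ∧
    reflWord l (Pi.single 2 1) = deltaVec - Pi.single 2 1 := by
  have step : ∀ {c : Fin 10 → ℤ} (i j : Fin 10) (d : Fin 10 → ℤ), i ≠ 0 → j ≠ 0 →
      refl j (refl i c) = d → (∃ l : List (Fin 10), (∀ i ∈ l, i ≠ 0) ∧
        reflWord l d = deltaVec - Pi.single 2 1) →
      ∃ l : List (Fin 10), (∀ i ∈ l, i ≠ 0) ∧ reflWord l c = deltaVec - Pi.single 2 1 := by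
    rintro c i j _ hi hj rfl ⟨l, hl, h⟩
    exact ⟨i :: j :: l, by simpa using ⟨hi, hj, hl⟩, h⟩
  -- A climb from height 1 to height 29: each of the 28 reflections adds one simple root.
  refine step 1 3 ![0, 1, 1, 1, 0, 0, 0, 0, 0, 0] (by decide) (by decide) (by decide) ?_
  refine step 4 5 ![0, 1, 1, 1, 1, 1, 0, 0, 0, 0] (by decide) (by decide) (by decide) ?_
  refine step 6 7 ![0, 1, 1, 1, 1, 1, 1, 1, 0, 0] (by decide) (by decide) (by decide) ?_
  refine step 8 9 ![0, 1, 1, 1, 1, 1, 1, 1, 1, 1] (by decide) (by decide) (by decide) ?_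
  refine step 6 5 ![0, 1, 1, 1, 1, 2, 2, 1, 1, 1] (by decide) (by decide) (by decide) ?_
  refine step 4 3 ![0, 1, 1, 2, 2, 2, 2, 1, 1, 1] (by decide) (by decide) (by decide) ?_
  refine step 7 6 ![0, 1, 1, 2, 2, 2, 3, 2, 1, 1] (by decide) (by decide) (by decide) ?_
  refine step 5 4 ![0, 1, 1, 2, 3, 3, 3, 2, 1, 1] (by decide) (by decide) (by decide) ?_
  refine step 9 6 ![0, 1, 1, 2, 3, 3, 4, 2, 1, 2] (by decide) (by decide) (by decide) ?_
  refine step 5 7 ![0, 1, 1, 2, 3, 4, 4, 3, 1, 2] (by decide) (by decide) (by decide) ?_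
  refine step 6 8 ![0, 1, 1, 2, 3, 4, 5, 3, 2, 2] (by decide) (by decide) (by decide) ?_
  refine step 7 9 ![0, 1, 1, 2, 3, 4, 5, 4, 2, 3] (by decide) (by decide) (by decide) ?_
  refine step 6 5 ![0, 1, 1, 2, 3, 5, 6, 4, 2, 3] (by decide) (by decide) (by decide) ?_
  refine step 4 3 ![0, 1, 1, 3, 4, 5, 6, 4, 2, 3] (by decide) (by decide) (by decide) ?_
  exact ⟨[], by simp, by decide⟩

/-- An affine Weyl group element sends a simple root `α` to `n δ - α`. -/
theorem exists_word_smul_delta_sub (n : ℕ) : ∃ l : List (Fin 10), (∀ i ∈ l, i ≠ 0) ∧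
    reflWord l (Pi.single 2 1) = (n : ℤ) • deltaVec - Pi.single 2 1 := by
  have h2 : refl 2 (Pi.single 2 1) = -Pi.single 2 1 := by decide
  induction n with
  | zero => exact ⟨[2], by simp, by rw [reflWord, h2]; simp [reflWord]⟩
  | succ n ih =>
    obtain ⟨l, hl, h⟩ := ih
    obtain ⟨m, hm, h'⟩ := exists_word_delta_sub
    -- Letters act from left to right: after `l`, r_2 turns nδ - α_2 into nδ + α_2, and `m` turns
    -- this into (n+1)δ - α_2.
    refine ⟨l ++ ([2] ++ m), ?_, ?_⟩
    · intro i hi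
      simp only [List.mem_append, List.mem_singleton] at hi
      rcases hi with hi | rfl | hi
      exacts [hl i hi, by decide, hm i hi]
    · rw [reflWord_append, h, reflWord_append, reflWord_sub,
        reflWord_smul_delta (by simp), reflWord_sub, reflWord_smul_delta hm]
      change _ - reflWord m (refl 2 (Pi.single 2 1)) = _
      rw [h2, reflWord_neg, h']
      push_cast
      module

/-! ### Brackets near the weight nδ. -/

theorem qnorm_delta_add {i j : Fin 10} (hi : i ≠ 0) (hj : j ≠ 0) (n a b : ℤ) :
    qnorm (n • deltaVec + a • Pi.single i 1 + b • Pi.single j 1) =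
      2 * a ^ 2 + 2 * b ^ 2 + 2 * a * b * cartanMatrix j i := by
  have h0 : qnorm (n • deltaVec) = 0 := by
    have h1 : qnorm deltaVec = 0 := by decide
    simp only [qnorm, pairing_zsmul, Pi.smul_apply, smul_eq_mul] at h1 ⊢
    have : ∀ x, n * deltaVec x * (n * pairing deltaVec x) =
        n ^ 2 * (deltaVec x * pairing deltaVec x) := fun x => by ring
    simp only [this, ← Finset.mul_sum, h1, mul_zero]
  rw [qnorm_add_single, qnorm_add_single, h0, pairing_add, pairing_zsmul, pairing_zsmul,
    pairing_zsmul, pairing_deltaVec hi, pairing_deltaVec hj, pairing_single]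
  ring

/-- δ is isotropic and orthogonal to the affine simple roots, so only a and b enter the norm; beyond
2 the weight is not a root. -/
theorem lie_eq_zero_of_qnorm {i j : Fin 10} (hi : i ≠ 0) (hj : j ≠ 0) (n a b : ℤ)
    {c d : Fin 10 → ℤ} {x y : Alg} (hx : x ∈ gs c) (hy : y ∈ gs d)
    (hcd : c + d = n • deltaVec + a • Pi.single i 1 + b • Pi.single j 1)
    (h : 2 < 2 * a ^ 2 + 2 * b ^ 2 + 2 * a * b * cartanMatrix j i) : ⁅x, y⁆ = 0 := by
  have h1 := lie_mem_gs hx hy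
  rw [gs_eq_bot (by rwa [hcd, qnorm_delta_add hi hj])] at h1
  exact h1

theorem lie_genH_of_mem {n : ℤ} {i j : Fin 10} (hj : j ≠ 0) {y : Alg}
    (hy : y ∈ gs (n • deltaVec - Pi.single i 1)) :
    ⁅genH j, y⁆ = (-cartanMatrix j i : ℂ) • y := by
  rw [mem_gs.1 hy j, pairing_sub, pairing_zsmul, pairing_deltaVec hj, pairing_single]
  push_cast
  rw [mul_zero, zero_sub]

section

variable {n : ℤ} {i j : Fin 10} {y : Alg}

theorem lie_genF_mem (hy : y ∈ gs (n • deltaVec - Pi.single i 1)) :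
    ⁅genF j, y⁆ ∈ gs (-Pi.single j 1 + (n • deltaVec - Pi.single i 1)) :=
  lie_mem_gs (genF_mem_gs j) hy

theorem lie_genE_mem (hy : y ∈ gs (n • deltaVec - Pi.single i 1)) :
    ⁅genE i, y⁆ ∈ gs (n • deltaVec) := by
  have := lie_mem_gs (genE_mem_gs i) hy
  rwa [add_sub_cancel] at this

theorem lie_genF_lie_genE_of_ne (hij : i ≠ j) :
    ⁅genF j, ⁅genE i, y⁆⁆ = ⁅genE i, ⁅genF j, y⁆⁆ := by
  rw [leibniz_lie, ← lie_skew (genF j) (genE i), lie_genE_genF, if_neg hij]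
  simp

theorem lie_genF_lie_genE_self (hi : i ≠ 0) (hy : y ∈ gs (n • deltaVec - Pi.single i 1)) :
    ⁅genF i, ⁅genE i, y⁆⁆ = (2 : ℂ) • y := by
  have h : ⁅genF i, y⁆ = 0 := lie_eq_zero_of_qnorm hi hi n (-2) 0 (genF_mem_gs i) hy (by module)
    (by norm_num)
  rw [leibniz_lie, h, lie_zero, lie_genF_genE_self, neg_lie, lie_genH_of_mem hi hy,
    cartanMatrix_self]
  simp

theorem lie_genF_lie_genE_of_nonadjacent (hi : i ≠ 0) (hj : j ≠ 0) (hij : i ≠ j)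
    (ha : cartanMatrix j i = 0) (hy : y ∈ gs (n • deltaVec - Pi.single i 1)) :
    ⁅genF j, ⁅genE i, y⁆⁆ = 0 := by
  have h : ⁅genF j, y⁆ = 0 := lie_eq_zero_of_qnorm hi hj n (-1) (-1) (genF_mem_gs j) hy (by module)
    (by rw [ha]; norm_num)
  rw [lie_genF_lie_genE_of_ne hij, h, lie_zero]

/-- The transport of a vector of weight `n δ - α_i` to the weight `n δ - α_j`. -/
def transport (i j : Fin 10) (y : Alg) : Alg := -⁅genE i, ⁅genF j, y⁆⁆

theorem transport_mem (hy : y ∈ gs (n • deltaVec - Pi.single i 1)) :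
    transport i j y ∈ gs (n • deltaVec - Pi.single j 1) := by
  have h := lie_mem_gs (genE_mem_gs i) (lie_genF_mem (j := j) hy)
  rw [show Pi.single i 1 + (-Pi.single j 1 + (n • deltaVec - Pi.single i 1)) =
    n • deltaVec - Pi.single j 1 by abel] at h
  exact neg_mem h

/-- Along an edge, nδ - 2α_i - α_j and nδ - α_i + α_j have norm 6, so only the sl₂ terms survive.
Hence transport preserves nonvanishing; its sign is the one that gives [f_j,[e_i,y_i]] = a_ji y_j.
-/
theorem transport_transport (hi : i ≠ 0) (hj : j ≠ 0) (ha : cartanMatrix i j = -1)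
    (hy : y ∈ gs (n • deltaVec - Pi.single i 1)) : transport j i (transport i j y) = y := by
  have ha' : cartanMatrix j i = -1 := by rw [cartanMatrix_comm, ha]
  have hz := lie_genF_mem (j := j) hy
  have h1 : ⁅genF i, ⁅genF j, y⁆⁆ = 0 :=
    lie_eq_zero_of_qnorm hi hj n (-2) (-1) (genF_mem_gs i) hz (by module) (by rw [ha']; norm_num)
  have h2 : ⁅genE j, y⁆ = 0 :=
    lie_eq_zero_of_qnorm hi hj n (-1) 1 (genE_mem_gs j) hy (by module) (by rw [ha']; norm_num)
  have h3 : ⁅genF i, ⁅genE i, ⁅genF j, y⁆⁆⁆ = ⁅genF j, y⁆ := by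
    rw [leibniz_lie, h1, lie_zero, add_zero, lie_genF_genE_self, neg_lie, mem_gs.1 hz i,
      pairing_add, pairing_sub, pairing_neg, pairing_zsmul, pairing_deltaVec hi, pairing_single,
      pairing_single, ha, cartanMatrix_self]
    simp
  rw [transport, transport, lie_neg, lie_neg, neg_neg, h3, leibniz_lie, h2, lie_zero, add_zero,
    lie_genE_genF_self, lie_genH_of_mem hj hy, ha']
  simp

/-- As nδ ± 2α_i are not roots, z lies in a sum of adjoint and trivial representations of the i-th
sl₂; on their zero weight spaces the product of the three exponentials is 1 - ef. -/
theorem weylAut_apply_of_mem (hi : i ≠ 0) {z : Alg} (hz : z ∈ gs (n • deltaVec)) :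
    weylAut i z = z - ⁅genE i, ⁅genF i, z⁆⁆ := by
  have hh : ⁅genH i, z⁆ = 0 := by
    rw [mem_gs.1 hz, pairing_zsmul, pairing_deltaVec hi]; simp
  have hE := lie_mem_gs (genE_mem_gs i) hz
  have hF := lie_mem_gs (genF_mem_gs i) hz
  have hee : ⁅genE i, ⁅genE i, z⁆⁆ = 0 :=
    lie_eq_zero_of_qnorm hi hi n 2 0 (genE_mem_gs i) hE (by module) (by norm_num)
  have hff : ⁅genF i, ⁅genF i, z⁆⁆ = 0 :=
    lie_eq_zero_of_qnorm hi hi n (-2) 0 (genF_mem_gs i) hF (by module) (by norm_num)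
  have hfe : ⁅genF i, ⁅genE i, z⁆⁆ = ⁅genE i, ⁅genF i, z⁆⁆ := by
    rw [leibniz_lie, lie_genF_genE_self, neg_lie, hh, neg_zero, zero_add]
  have hhE : ⁅genH i, ⁅genE i, z⁆⁆ = (2 : ℂ) • ⁅genE i, z⁆ := by
    rw [leibniz_lie, hh, lie_zero, add_zero, lie_genH_genE, cartanMatrix_self, smul_lie]
    norm_num
  have hhF : ⁅genH i, ⁅genF i, z⁆⁆ = -(2 : ℂ) • ⁅genF i, z⁆ := by
    rw [leibniz_lie, hh, lie_zero, add_zero, lie_genH_genF, cartanMatrix_self, smul_lie]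
    norm_num
  have heef : ⁅genE i, ⁅genE i, ⁅genF i, z⁆⁆⁆ = (2 : ℂ) • ⁅genE i, z⁆ := by
    rw [← hfe, leibniz_lie (genE i) (genF i), lie_genE_genF_self, hhE, hee, lie_zero, add_zero]
  have hfef : ⁅genF i, ⁅genE i, ⁅genF i, z⁆⁆⁆ = (2 : ℂ) • ⁅genF i, z⁆ := by
    rw [leibniz_lie (genF i), hff, lie_zero, add_zero, lie_genF_genE_self, neg_lie, hhF]
    module
  have h1 : expE i z = z + ⁅genE i, z⁆ := adExp_of_lie_lie_eq_zero hee
  have h2 : expF i z = z - ⁅genF i, z⁆ := by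
    rw [expF, adExpEquiv_apply, adExp_of_lie_lie_eq_zero, neg_lie, sub_eq_add_neg]
    rw [neg_lie, neg_lie, lie_neg, hff, neg_zero, neg_zero]
  have h3 : expF i ⁅genE i, z⁆ = ⁅genE i, z⁆ - ⁅genE i, ⁅genF i, z⁆⁆ + ⁅genF i, z⁆ := by
    rw [expF, adExpEquiv_apply, adExp_of_lie_lie_lie_eq_zero]
    · rw [neg_lie, neg_lie, lie_neg, neg_neg, hfe, hfef]
      module
    · rw [neg_lie, neg_lie, neg_lie, lie_neg, neg_neg, hfe, lie_neg, hfef, lie_neg, lie_smul, hff,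
        smul_zero, neg_zero]
  have h4 : expE i ⁅genE i, z⁆ = ⁅genE i, z⁆ := adExp_of_lie_eq_zero hee
  have h5 : expE i ⁅genE i, ⁅genF i, z⁆⁆ = ⁅genE i, ⁅genF i, z⁆⁆ + (2 : ℂ) • ⁅genE i, z⁆ := by
    rw [expE, adExpEquiv_apply, adExp_of_lie_lie_eq_zero]
    · rw [heef]
    · rw [heef, lie_smul, hee, smul_zero]
  rw [weylAut_apply, h1, map_add, h2, h3,
    show z - ⁅genF i, z⁆ + (⁅genE i, z⁆ - ⁅genE i, ⁅genF i, z⁆⁆ + ⁅genF i, z⁆) =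
      z + ⁅genE i, z⁆ - ⁅genE i, ⁅genF i, z⁆⁆ by abel,
    map_sub, map_add, h1, h4, h5]
  module

end

/-- Compatible generators of the root spaces of the `n δ - α_i`, for the affine simple roots. -/
theorem exists_nullBasis (n : ℕ) : ∃ y : Fin 10 → Alg, y 0 = 0 ∧
    (∀ i, i ≠ 0 → y i ∈ gs ((n : ℤ) • deltaVec - Pi.single i 1) ∧ y i ≠ 0) ∧
    ∀ i j, i ≠ 0 → j ≠ 0 → ⁅genF j, ⁅genE i, y i⁆⁆ = (cartanMatrix j i : ℂ) • y j := by
  obtain ⟨l, hl, h⟩ := exists_word_smul_delta_sub n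
  -- The image of e_2 under an automorphism is nonzero, which gives a root vector of weight nδ -
  -- α_2; transport along the affine tree gives the others.
  set y2 := weylAutWord l (genE 2)
  have good2 : y2 ∈ gs ((n : ℤ) • deltaVec - Pi.single 2 1) ∧ y2 ≠ 0 := by
    refine ⟨h ▸ weylAutWord_mem l (genE_mem_gs 2), fun h0 => genE_ne_zero 2 ?_⟩
    exact EquivLike.injective (weylAutWord l) (h0.trans (map_zero (weylAutWord l)).symm)
  let y3 := transport 2 3 y2
  let y4 := transport 3 4 y3
  let y5 := transport 4 5 y4
  let y6 := transport 5 6 y5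
  let y7 := transport 6 7 y6
  let y : Fin 10 → Alg := ![0, transport 2 1 y2, y2, y3, y4, y5, y6, y7, transport 7 8 y7,
    transport 6 9 y6]
  -- The affine diagram as a tree rooted at 2; the values at 0 and 2 are placeholders.
  let parent : Fin 10 → Fin 10 := ![0, 2, 2, 2, 3, 4, 5, 6, 7, 6]
  have hdef : ∀ j, j ≠ 0 → j ≠ 2 → y j = transport (parent j) j (y (parent j)) := by
    intro j h0 h2
    fin_cases j
    all_goals first | exact (h0 rfl).elim | exact (h2 rfl).elim | rfl
  have hpar : ∀ j, j ≠ 0 → j ≠ 2 → parent j ≠ 0 ∧ cartanMatrix (parent j) j + 0 = -1 := by decide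
  have step : ∀ j, j ≠ 0 → j ≠ 2 →
      (y (parent j) ∈ gs ((n : ℤ) • deltaVec - Pi.single (parent j) 1) ∧ y (parent j) ≠ 0) →
      (y j ∈ gs ((n : ℤ) • deltaVec - Pi.single j 1) ∧ y j ≠ 0) := by
    intro j h0 h2 ⟨hm, hne⟩
    obtain ⟨h1, ha⟩ := hpar j h0 h2
    rw [add_zero] at ha
    rw [hdef j h0 h2]
    refine ⟨transport_mem hm, fun hz => hne ?_⟩
    rw [← transport_transport h1 h0 ha hm, hz]
    simp [transport]
  have g3 := step 3 (by decide) (by decide) good2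
  have g4 := step 4 (by decide) (by decide) g3
  have g5 := step 5 (by decide) (by decide) g4
  have g6 := step 6 (by decide) (by decide) g5
  have g7 := step 7 (by decide) (by decide) g6
  have good : ∀ i, i ≠ 0 → y i ∈ gs ((n : ℤ) • deltaVec - Pi.single i 1) ∧ y i ≠ 0 := by
    intro i h0
    fin_cases i
    exacts [(h0 rfl).elim, step 1 (by decide) (by decide) good2, good2, g3, g4, g5, g6, g7,
      step 8 (by decide) (by decide) g7, step 9 (by decide) (by decide) g6]
  have hadj : ∀ i j, i ≠ 0 → j ≠ 0 → cartanMatrix i j + 0 = -1 →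
      (j ≠ 2 ∧ i = parent j) ∨ (i ≠ 2 ∧ j = parent i) := by decide
  refine ⟨y, rfl, good, fun i j hi hj => ?_⟩
  obtain ⟨rfl, ha⟩ | ⟨hij, ha, hb⟩ | ⟨hij, ha, hb⟩ := cartanMatrix_trichotomy i j
  · rw [lie_genF_lie_genE_self hi (good i hi).1, ha]
    norm_num
  · rw [lie_genF_lie_genE_of_nonadjacent hi hj hij hb (good i hi).1, hb]
    simp
  · have htr : transport i j (y i) = y j := by
      rcases hadj i j hi hj (by rw [ha, add_zero]) with ⟨h2, rfl⟩ | ⟨h2, rfl⟩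
      · exact (hdef j hj h2).symm
      · rw [hdef i hi h2]
        exact transport_transport hj hi hb (good _ hj).1
    rw [lie_genF_lie_genE_of_ne hij, hb, ← htr, transport, Int.cast_neg, Int.cast_one, neg_smul,
      one_smul, neg_neg]

/-! ### The root space of nδ. -/

section

variable {n : ℕ} {y : Fin 10 → Alg}

/-- Bracketing with f_j reads off the j-th entry of Av from ∑ v_i x_i; this detects every linear
relation among the x_i up to the kernel of the affine matrix. -/
theorem lie_genF_sum
    (hy : ∀ i j, i ≠ 0 → j ≠ 0 → ⁅genF j, ⁅genE i, y i⁆⁆ = (cartanMatrix j i : ℂ) • y j)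
    {v : Fin 10 → ℂ} (hv : v 0 = 0) {j : Fin 10} (hj : j ≠ 0) :
    ⁅genF j, ∑ i, v i • ⁅genE i, y i⁆⁆ = (∑ i, (cartanMatrix j i : ℂ) * v i) • y j := by
  rw [lie_sum, Finset.sum_smul]
  refine Finset.sum_congr rfl fun i _ => ?_
  by_cases hi : i = 0
  · subst hi
    simp [hv]
  · rw [lie_smul, hy i j hi hj, smul_smul, mul_comm]

/-- Equivariance of α_i ↦ x_i: subtracting [e_k,[f_k,z]] from z subtracts `pairing c k` times x_k,
exactly as r_k acts on coordinates. -/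
theorem weylAutWord_sum (h0 : y 0 = 0)
    (hm : ∀ i, i ≠ 0 → y i ∈ gs ((n : ℤ) • deltaVec - Pi.single i 1))
    (hy : ∀ i j, i ≠ 0 → j ≠ 0 → ⁅genF j, ⁅genE i, y i⁆⁆ = (cartanMatrix j i : ℂ) • y j)
    {l : List (Fin 10)} (hl : ∀ i ∈ l, i ≠ 0) {c : Fin 10 → ℤ} (hc : c 0 = 0) :
    weylAutWord l (∑ i, (c i : ℂ) • ⁅genE i, y i⁆) =
      ∑ i, (reflWord l c i : ℂ) • ⁅genE i, y i⁆ := by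
  induction l generalizing c with
  | nil => rfl
  | cons k l ih =>
    rw [List.forall_mem_cons] at hl
    have hmem : ∑ i, (c i : ℂ) • ⁅genE i, y i⁆ ∈ gs ((n : ℤ) • deltaVec) := by
      refine sum_mem fun i _ => Submodule.smul_mem _ _ ?_
      by_cases hi : i = 0
      · subst hi
        rw [h0, lie_zero]; exact zero_mem _
      · exact lie_genE_mem (hm i hi)
    have hp : ∑ i, (cartanMatrix k i : ℂ) * (c i : ℂ) = (pairing c k : ℂ) := by
      simp [pairing]
    rw [weylAutWord_cons, weylAut_apply_of_mem hl.1 hmem,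
      lie_genF_sum (v := fun i => (c i : ℂ)) hy (by simp [hc]) hl.1, hp, lie_smul, reflWord,
      ← ih hl.2 (by rw [refl_apply_of_ne hl.1.symm, hc])]
    congr 1
    simp only [refl, Pi.sub_apply, Pi.smul_apply, smul_eq_mul, Int.cast_sub, Int.cast_mul, sub_smul,
      Finset.sum_sub_distrib]
    congr 1
    rw [Finset.sum_eq_single k]
    · simp
    · intro i _ hi; simp [hi]
    · simp

/-- The linear relation between the generators of the root space of `n δ`. -/
theorem sum_deltaVec_smul_eq_zero (hn : n ≠ 0) (h0 : y 0 = 0)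
    (hm : ∀ i, i ≠ 0 → y i ∈ gs ((n : ℤ) • deltaVec - Pi.single i 1) ∧ y i ≠ 0)
    (hy : ∀ i j, i ≠ 0 → j ≠ 0 → ⁅genF j, ⁅genE i, y i⁆⁆ = (cartanMatrix j i : ℂ) • y j) :
    ∑ i, (deltaVec i : ℂ) • ⁅genE i, y i⁆ = 0 := by
  obtain ⟨l, hl, h⟩ := exists_word_smul_delta_sub n
  have h2 : (2 : Fin 10) ≠ 0 := by decide
  obtain ⟨hy2, hy2'⟩ := hm 2 h2
  have hsingle : ⁅genE 2, y 2⁆ = ∑ i, ((Pi.single 2 1 : Fin 10 → ℤ) i : ℂ) • ⁅genE i, y i⁆ := by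
    rw [Finset.sum_eq_single 2]
    · simp
    · intro i _ hi; simp [hi]
    · simp
  have h3 : weylAutWord l ⁅genE 2, y 2⁆ =
      (n : ℂ) • ∑ i, (deltaVec i : ℂ) • ⁅genE i, y i⁆ - ⁅genE 2, y 2⁆ := by
    have h4 := weylAutWord_sum h0 (fun i hi => (hm i hi).1) hy hl (c := Pi.single 2 1) (by decide)
    rw [← hsingle, h] at h4
    rw [h4, hsingle, Finset.smul_sum, ← Finset.sum_sub_distrib]
    refine Finset.sum_congr rfl fun i _ => ?_
    rw [smul_smul, ← sub_smul]
    simp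
  have hqs : qnorm (Pi.single 2 1) = 2 := by decide
  have hq : qnorm ((n : ℤ) • deltaVec - Pi.single 2 1) = 2 := by
    have := qnorm_delta_add h2 h2 n (-1) 0
    rw [show (n : ℤ) • deltaVec + (-1 : ℤ) • Pi.single (2 : Fin 10) (1 : ℤ) +
        (0 : ℤ) • Pi.single 2 1 =
      (n : ℤ) • deltaVec - Pi.single 2 1 by module] at this
    rw [this]; norm_num
  -- The word also sends nδ - α_2 back to α_2, and both root spaces are lines; so the lift swaps the
  -- lines of e_2 and y_2 and multiplies x_2 by -ab.
  have hTe : weylAutWord l (genE 2) ∈ Submodule.span ℂ {y 2} :=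
    gs_le_span_singleton hq hy2 hy2' (h ▸ weylAutWord_mem l (genE_mem_gs 2))
  have hTy : weylAutWord l (y 2) ∈ Submodule.span ℂ {genE 2} := by
    refine gs_le_span_singleton hqs (genE_mem_gs 2) (genE_ne_zero 2) ?_
    have := weylAutWord_mem l hy2
    rwa [reflWord_sub, reflWord_smul_delta hl, h, sub_sub_cancel] at this
  obtain ⟨a, ha⟩ := Submodule.mem_span_singleton.1 hTe
  obtain ⟨b, hb⟩ := Submodule.mem_span_singleton.1 hTy
  have h5 : weylAutWord l ⁅genE 2, y 2⁆ = (-(a * b)) • ⁅genE 2, y 2⁆ := by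
    rw [LieEquiv.map_lie, ← ha, ← hb, smul_lie, lie_smul, smul_smul, ← lie_skew, neg_smul, smul_neg]
  have h6 : (n : ℂ) • ∑ i, (deltaVec i : ℂ) • ⁅genE i, y i⁆ = (1 - a * b) • ⁅genE 2, y 2⁆ := by
    rw [h5] at h3
    rw [sub_smul, one_smul, sub_eq_add_neg, ← neg_smul, h3]
    abel
  -- f_2 kills the δ-combination, as δ is orthogonal to α_2, and sends x_2 to 2 y_2 ≠ 0; hence ab =
  -- 1.
  have h7 : (1 - a * b) • ⁅genE 2, y 2⁆ = 0 := by
    have h8 := congrArg (fun x => ⁅genF 2, x⁆) h6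
    have hd : ∑ i, (cartanMatrix 2 i : ℂ) * (deltaVec i : ℂ) = 0 := by
      have := pairing_deltaVec h2
      rw [pairing] at this
      exact_mod_cast this
    simp only [lie_smul] at h8
    rw [lie_genF_sum (v := fun i => (deltaVec i : ℂ)) hy (by simp [deltaVec]) h2, hd, zero_smul,
      smul_zero, hy 2 2 h2 h2, smul_smul, cartanMatrix_self, eq_comm, smul_eq_zero] at h8
    have h9 := h8.resolve_right hy2'
    rw [mul_eq_zero] at h9
    rw [h9.resolve_right (by norm_num), zero_smul]
  rw [h7, smul_eq_zero] at h6
  exact h6.resolve_left (by exact_mod_cast hn)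

/-- g_{nδ} is the sum of the [e_i, g_{nδ-α_i}]. For i ≠ 0 the inner space is the line of y_i; for i
= 0 it is zero, the norm of nδ - α_0 being 2n + 2. -/
theorem gs_smul_delta_le (hn : 0 < n)
    (hm : ∀ i, i ≠ 0 → y i ∈ gs ((n : ℤ) • deltaVec - Pi.single i 1) ∧ y i ≠ 0) :
    gs ((n : ℤ) • deltaVec) ≤ Submodule.span ℂ (Set.range fun i => ⁅genE i, y i⁆) := by
  have hpos : (0 : Fin 10 → ℤ) ≤ deltaVec := by
    have : ∀ i, 0 ≤ deltaVec i := by decide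
    exact this
  have hd1 : deltaVec 1 = 1 := rfl
  have hd2 : deltaVec 2 = 2 := rfl
  refine (gs_le_iSup (smul_nonneg (by positivity) hpos) (fun h => ?_) (fun i h => ?_)).trans
    (iSup_le fun i => ?_)
  · have := congrFun h 1
    simp [hd1] at this
    omega
  · have h1 := congrFun h 1
    have h2 := congrFun h 2
    simp only [Pi.smul_apply, hd1, hd2, smul_eq_mul] at h1 h2
    by_cases hi : i = 1
    · subst hi
      simp at h2
      omega
    · rw [Pi.single_eq_of_ne (Ne.symm hi)] at h1
      omega
  · rintro _ ⟨z, hz, rfl⟩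
    rw [LieAlgebra.ad_apply]
    by_cases hi : i = 0
    · subst hi
      have hq : 2 < qnorm ((n : ℤ) • deltaVec - Pi.single 0 1) := by
        have h0 : qnorm ((n : ℤ) • deltaVec) = 0 := by
          have := qnorm_delta_add (i := 1) (j := 1) (by decide) (by decide) n 0 0
          simpa using this
        have h1 : pairing deltaVec 0 = -1 := by decide
        rw [sub_eq_add_neg, ← neg_one_smul ℤ, qnorm_add_single, h0, pairing_zsmul, h1]
        omega
      rw [gs_eq_bot hq] at hz
      rw [(Submodule.mem_bot ℂ).1 hz, lie_zero]
      exact zero_mem _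
    · obtain ⟨h1, h2⟩ := hm i hi
      have hq : qnorm ((n : ℤ) • deltaVec - Pi.single i 1) = 2 := by
        have := qnorm_delta_add hi hi n (-1) 0
        rw [show (n : ℤ) • deltaVec + (-1 : ℤ) • Pi.single i (1 : ℤ) + (0 : ℤ) • Pi.single i 1 =
          (n : ℤ) • deltaVec - Pi.single i 1 by module] at this
        rw [this]; norm_num
      obtain ⟨a, rfl⟩ := Submodule.mem_span_singleton.1 (gs_le_span_singleton hq h1 h2 hz)
      rw [lie_smul]
      exact Submodule.smul_mem _ _ (Submodule.subset_span ⟨i, rfl⟩)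

end

theorem eq_zero_of_cartanMatrix_mul {v : Fin 10 → ℂ}
    (h : ∀ j, ∑ i, (cartanMatrix j i : ℂ) * v i = 0) : v = 0 := by
  ext i
  have h1 : ∑ k, (cartanMatrixInv i k : ℂ) * ∑ j, (cartanMatrix k j : ℂ) * v j = v i := by
    simp only [Finset.mul_sum]
    rw [Finset.sum_comm]
    simp only [← mul_assoc, ← Finset.sum_mul]
    have h2 : ∀ j, ∑ k, (cartanMatrixInv i k : ℂ) * (cartanMatrix k j : ℂ) =
        if i = j then 1 else 0 := fun j => by
      exact_mod_cast congrArg (Int.cast : ℤ → ℂ) (cartanMatrixInv_mul i j)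
    simp [h2]
  rw [← h1]
  simp [h]

/-- Since δ has coefficient 1 at index 1, the relation eliminates x_1; the remaining eight x_i are a
basis. -/
theorem multiplicity_smul_delta_of_pos {n : ℕ} (hn : 0 < n) :
    multiplicity (root ((n : ℤ) • deltaVec)) = 8 := by
  obtain ⟨y, h0, hm, hy⟩ := exists_nullBasis n
  set x : Fin 10 → Alg := fun i => ⁅genE i, y i⁆ with hx
  have hx0 : x 0 = 0 := by rw [hx]; simp [h0]
  have hrel : ∑ i, (deltaVec i : ℂ) • x i = 0 := sum_deltaVec_smul_eq_zero hn.ne' h0 hm hy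
  let b : Fin 8 → Alg := fun k => x k.succ.succ
  have hsum : ∀ v : Fin 8 → ℂ, ∑ k, v k • b k =
      ∑ i, (Fin.cons 0 (Fin.cons 0 v : Fin 9 → ℂ) : Fin 10 → ℂ) i • x i := fun v => by
    rw [Fin.sum_univ_succ (n := 9), Fin.sum_univ_succ (n := 8)]
    simp [b]
  have hli : LinearIndependent ℂ b := by
    rw [Fintype.linearIndependent_iff]
    intro v hv
    rw [hsum] at hv
    -- Row 0 of A is supported on indices 0 and 1, where the padded v vanishes; so Av = 0 holds in
    -- all ten rows, and invertibility of A stands in for that of the E₈ matrix.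
    have h1 := eq_zero_of_cartanMatrix_mul (v := Fin.cons 0 (Fin.cons 0 v : Fin 9 → ℂ)) (fun j => by
      by_cases hj : j = 0
      · subst hj
        have hz : ∀ k : Fin 8, cartanMatrix 0 k.succ.succ = 0 := by decide
        rw [Fin.sum_univ_succ, Fin.sum_univ_succ]
        simp [hz]
      · have h2 := lie_genF_sum (v := Fin.cons 0 (Fin.cons 0 v : Fin 9 → ℂ)) hy rfl hj
        rw [show ∑ i, (Fin.cons 0 (Fin.cons 0 v : Fin 9 → ℂ) : Fin 10 → ℂ) i • ⁅genE i, y i⁆ = 0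
          from hv, lie_zero, eq_comm, smul_eq_zero] at h2
        exact h2.resolve_right (hm j hj).2)
    exact fun k => congrFun h1 k.succ.succ
  have hspan : gs ((n : ℤ) • deltaVec) = Submodule.span ℂ (Set.range b) := by
    apply le_antisymm
    · refine (gs_smul_delta_le hn hm).trans (Submodule.span_le.2 ?_)
      rintro _ ⟨i, rfl⟩
      have hb : ∀ k, b k ∈ Submodule.span ℂ (Set.range b) := fun k => Submodule.subset_span ⟨k, rfl⟩
      induction i using Fin.cases with
      | zero =>
        change x 0 ∈ _
        rw [hx0]
        exact zero_mem _
      | succ i =>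
        induction i using Fin.cases with
        | zero =>
          rw [Fin.sum_univ_succ, Fin.sum_univ_succ, hx0, smul_zero, zero_add] at hrel
          have h1 : ((deltaVec (Fin.succ 0) : ℤ) : ℂ) = 1 := by simp [deltaVec]
          rw [h1, one_smul, add_eq_zero_iff_eq_neg] at hrel
          change x (Fin.succ 0) ∈ _
          rw [hrel]
          exact neg_mem (sum_mem fun k _ => Submodule.smul_mem _ _ (hb k))
        | succ k => exact hb k
    · rw [Submodule.span_le]
      rintro _ ⟨k, rfl⟩
      exact lie_genE_mem (hm _ (Fin.succ_ne_zero _)).1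
  change Module.rank ℂ (gs ((n : ℤ) • deltaVec)) = 8
  rw [hspan, rank_span hli, Cardinal.mk_range_eq _ hli.injective]
  simp

end ETen

end

/-! ### Conclusion for positive and negative isotropic roots. -/

theorem mainTheorem8 (α : Module.Dual ℝ ETen.Cartan) (hα : α ∈ ETen.imaginaryRoots)
    (hiso : ETen.form α α = 0) :
    (∃ w ∈ ETen.weylGroup, ∃ n : ℤ, n ≠ 0 ∧ w α = n • ETen.delta) ∧
      ETen.multiplicity α = 8 := by
  obtain ⟨⟨hbot, h0⟩, -⟩ := hα
  have key : ∀ c : Fin 10 → ℤ, 0 ≤ c → c ≠ 0 → ETen.gs c ≠ ⊥ → ETen.qnorm c = 0 →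
      ∃ w ∈ ETen.weylGroup, ∃ n : ℤ, 0 < n ∧ w (ETen.root c) = n • ETen.delta ∧
        ETen.multiplicity (ETen.root c) = 8 := by
    intro c hc hc0 hcb hq
    obtain ⟨w, hw, ⟨h1, -⟩ | ⟨-, n, hn, h1⟩⟩ := ETen.exists_weyl_of_pos hc hc0 hcb hq.ge
    · omega
    · refine ⟨w, hw, n, hn, by rw [h1, map_zsmul, ETen.root_deltaVec], ?_⟩
      lift n to ℕ using hn.le
      rw [← ETen.multiplicity_weyl hw, h1]
      exact ETen.multiplicity_smul_delta_of_pos (by exact_mod_cast hn)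
  obtain ⟨c, hc, hc0, rfl | rfl⟩ := ETen.root_cases hbot h0
  · rw [ETen.form_root_self] at hiso
    obtain ⟨w, hw, n, hn, h1, h2⟩ := key c hc hc0 hbot (by exact_mod_cast hiso)
    exact ⟨⟨w, hw, n, hn.ne', h1⟩, h2⟩
  · rw [ETen.form_root_self, ETen.qnorm_neg] at hiso
    obtain ⟨w, hw, n, hn, h1, h2⟩ := key c hc hc0 (by
      have := ETen.gs_neg_ne_bot hbot
      rwa [neg_neg] at this) (by exact_mod_cast hiso)
    refine ⟨⟨w, hw, -n, by omega, ?_⟩, ?_⟩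
    · rw [map_neg, map_neg, h1, neg_smul]
    · rw [map_neg, ETen.multiplicity_neg, h2]
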